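/- Let $H=L^2(\mathbb R,dt)$ (real-valued functions), $H_{\mathbb C}=L^2(\mathbb R,\mathbb C,dt)$, with the bilinear form $\langle\xi,\eta\rangle=\int\xi\eta\,dt$. Let $A$ be a positive self-adjoint operator in $H$ with $\inf\sigma(A)>1$ and Hilbert–Schmidt inverse. For $p\in\mathbb R$ put $|f|_p=|(A^{\otimes n})^p f|_0$ for tensors $f$ of order $n$ (where $|\cdot|_0$ is the Hilbert norm of $H_{\mathbb C}^{\otimes n}$), and let $E_{\mathbb C}=\{\xi\in H_{\mathbb C}: |\xi|_p<\infty \text{ for all } p\in\mathbb R\}$. Let $0\le\beta<1$. Via the Wiener–Itô chaos decomposition, let $(E)_\beta$ be the space of all $\varphi\sim(f_n)_{n\ge0}$, $f_n\in H_{\mathbb C}^{\hat\otimes n}$ (symmetric tensors), such that $$|\varphi|_{p,\beta}=\Big(\sum_{n=0}^\infty (n!)^{1+\beta}|f_n|_p^2\Big)^{1/2}<\infty\quad\text{for all }p\in\mathbb R,$$ with the locally convex topology defined by the norms $|\cdot|_{p,\beta}$, and let $(E)_\beta^*$ be its topological dual with the strong topology and $\langle\!\langle\cdot,\cdot\rangle\!\rangle$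 the dual pairing. For $\xi\in E_{\mathbb C}$ let $\Phi_\xi\sim(\xi^{\otimes n}/n!)_{n\ge 0}\in(E)_\beta$, and for $\Psi\in(E)_\beta^*$ let $S(\Psi)(\xi)=\langle\!\langle\Psi,\Phi_\xi\rangle\!\rangle$, $\xi\in E_{\mathbb C}$, be its $S$-transform. Let $L((E)_\beta,(E)_\beta)$, the space of continuous linear operators on $(E)_\beta$, carry the topology of uniform convergence on bounded sets. Then $S$ is injective, and for all $\varphi,\psi\in(E)_\beta^*$ the Wick product $\varphi\diamond\psi=S^{-1}(S(\varphi)\cdot S(\psi))\in(E)_\beta^*$ exists. For each $\varphi\in(E)_\beta^*$ the Wick multiplication $\widetilde M_\varphi:\psi\mapsto\varphi\diamond\psi$ is a continuous linear operator on $(E)_\beta^*$, and it has a dual operator $C_\varphi\in L((E)_\beta,(E)_\beta)$ (the convolution operator), given by $\langle\!\langle\psi,C_\varphi f\rangle\!\rangle=\langle\!\langle\varphi\diamond\psi,f\rangle\!\rangle$ for all $\psi\in(E)_\beta^*$, $f\in(E)_\beta$. The map $$C:((E)_\beta^*,+,\cdot,\diamond)\to(L((E)_\beta,(E)_\beta),+,\cdot,\circ),\qquad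 \varphi\mapsto C_\varphi,$$ is an injective, continuous homomorphism of algebras: it is linear, $C_{\varphi\diamond\psi}=C_\varphi\circ C_\psi$ for all $\varphi,\psi$, and it maps the unit of $\diamond$ to the identity operator. Moreover $C$ is a topological isomorphism of $(E)_\beta^*$ onto its image $\mathrm{Im}(C)$ with the subspace topology. -/

import Mathlib

open MeasureTheory
open scoped ENNReal

noncomputable section

namespace WhiteNoise

/-- The real Hilbert space `H = L²(ℝ, dt)`. -/
abbrev RealL2 : Type := Lp ℝ 2 (volume : Measure ℝ)

/-- Its complexification `H_ℂ = L²(ℝ, ℂ, dt)`. -/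
abbrev ComplexL2 : Type := Lp ℂ 2 (volume : Measure ℝ)

/-- The (real) spectrum of a closed operator `A` in a real Hilbert space: the `z` for which
`A - z : D(A) → H` is not bijective (for a closed operator a bijective `A - z` has a bounded
inverse). For self-adjoint `A` this is the spectrum of the complexification of `A`. -/
def opSpectrum (A : RealL2 →ₗ.[ℝ] RealL2) : Set ℝ :=
  {z | ¬ Function.Bijective fun x : A.domain => A x - z • (x : RealL2)}

/-- The operators `A` that define the Gel'fand triple `E ⊂ L²(ℝ, dt) ⊂ E*`: positive self-adjoint
(in general unbounded) operators with `inf σ(A) > 1` whose inverse is Hilbert-Schmidt. -/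
structure TripleOperator where
  op : RealL2 →ₗ.[ℝ] RealL2
  selfAdjoint : IsSelfAdjoint op
  positive : ∀ x : op.domain, 0 ≤ inner ℝ (op x) (x : RealL2)
  one_lt_inf_spectrum : 1 < sInf (opSpectrum op)
  hilbertSchmidt_inverse : ∃ K : RealL2 →L[ℝ] RealL2,
    (∀ y, ∃ h : K y ∈ op.domain, op ⟨K y, h⟩ = y) ∧ (∀ x : op.domain, K (op x) = x) ∧
    ∃ (ι : Type) (b : HilbertBasis ι ℝ RealL2), Summable fun i => ‖K (b i)‖ ^ 2

/-! ### The eigenbasis of `A` -/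

section Spectral

variable {H : Type} [NormedAddCommGroup H] [InnerProductSpace ℝ H] [CompleteSpace H]

theorem isCompactOperator_of_summable {ι : Type} (b : HilbertBasis ι ℝ H) (K : H →L[ℝ] H)
    (hK : Summable fun i => ‖K (b i)‖ ^ 2) : IsCompactOperator K := by
  classical
  let F : Finset ι → H →L[ℝ] H := fun s => ∑ i ∈ s, (innerSL ℝ (b i)).smulRight (K (b i))
  have hFc : ∀ s, IsCompactOperator (F s) := by
    intro s
    have : F s ∈ compactOperator (RingHom.id ℝ) H H := by
      refine Submodule.sum_mem _ fun i _ => ?_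
      change IsCompactOperator ((innerSL ℝ (b i)).smulRight (K (b i)))
      have h1 : IsCompactOperator (ContinuousLinearMap.toSpanSingleton ℝ (K (b i))) := by
        have := (isCompactOperator_id_iff_finiteDimensional (𝕜 := ℝ) (E := ℝ)).2 inferInstance
        exact this.clm_comp (ContinuousLinearMap.toSpanSingleton ℝ (K (b i)))
      exact h1.comp_clm (innerSL ℝ (b i))
    exact this
  have htail := (tendsto_tsum_compl_atTop_zero fun i => ‖K (b i)‖ ^ 2)
  have hbound : ∀ s, ‖F s - K‖ ≤ Real.sqrt (∑' i : {x // x ∉ s}, ‖K (b i)‖ ^ 2) := by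
    intro s
    refine ContinuousLinearMap.opNorm_le_bound _ (Real.sqrt_nonneg _) fun x => ?_
    have hx : HasSum (fun i => b.repr x i • K (b i)) (K x) := by
      simpa using (b.hasSum_repr x).mapL K
    have hFx : F s x = ∑ i ∈ s, b.repr x i • K (b i) := by
      simp [F, b.repr_apply_apply]
    have h2 : HasSum (fun i : {x // x ∉ s} => b.repr x i • K (b i)) (K x - F s x) := by
      rw [hFx]
      refine (Finset.hasSum_compl_iff (f := fun i => b.repr x i • K (b i)) s).2 ?_
      rw [sub_add_cancel]
      exact hx
    rw [sub_apply, norm_sub_rev]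
    refine le_of_tendsto h2.norm (Filter.Eventually.of_forall fun t => ?_)
    refine (norm_sum_le _ _).trans ?_
    simp only [norm_smul]
    refine (Real.sum_mul_le_sqrt_mul_sqrt t _ _).trans ?_
    rw [mul_comm]
    have hb : ∑ i ∈ t, ‖b.repr x i‖ ^ 2 ≤ ‖x‖ ^ 2 := by
      have := b.orthonormal.sum_inner_products_le x (s := t.map (Function.Embedding.subtype _))
      simpa [b.repr_apply_apply] using this
    refine mul_le_mul (Real.sqrt_le_sqrt ?_) ?_ (Real.sqrt_nonneg _) (Real.sqrt_nonneg _)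
    · exact (hK.subtype _).sum_le_tsum t fun i _ => by positivity
    · exact (Real.sqrt_le_sqrt hb).trans (by rw [Real.sqrt_sq (norm_nonneg _)])
  refine isCompactOperator_of_tendsto (F := F) (l := Filter.atTop) ?_ (Filter.Eventually.of_forall hFc)
  rw [tendsto_iff_norm_sub_tendsto_zero]
  refine squeeze_zero (fun _ => norm_nonneg _) hbound ?_
  simpa using htail.sqrt

theorem exists_hilbertBasis_eigenvectors (T : H →L[ℝ] H) (hT : IsCompactOperator T)
    (hs : (T : H →ₗ[ℝ] H).IsSymmetric) :
    ∃ (ι : Type) (b : HilbertBasis ι ℝ H) (c : ι → ℝ), ∀ i, T (b i) = c i • b i := by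
  classical
  let V : ℝ → Submodule ℝ H := fun μ => Module.End.eigenspace (T : H →ₗ[ℝ] H) μ
  have hVmem : ∀ μ x, x ∈ V μ ↔ T x = μ • x := fun μ x => Module.End.mem_eigenspace_iff
  have hVc : ∀ μ, CompleteSpace (V μ) := by
    intro μ
    have : IsClosed (V μ : Set H) := by
      have : (V μ : Set H) = {x | T x = μ • x} := by ext x; exact hVmem μ x
      rw [this]
      exact isClosed_eq T.continuous (continuous_const_smul μ)
    exact this.completeSpace_coe
  choose w B hB using fun μ => exists_hilbertBasis ℝ (V μ)
  let v : (Σ μ, w μ) → H := fun a => (B a.1 a.2 : V a.1)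
  have hv : Orthonormal ℝ v :=
    hs.orthogonalFamily_eigenspaces.orthonormal_sigma_orthonormal fun μ => (B μ).orthonormal
  have hbot : (Submodule.span ℝ (Set.range v))ᗮ = ⊥ := by
    rw [eq_bot_iff]
    have key := ContinuousLinearMap.orthogonalComplement_iSup_eigenspaces_eq_bot hT hs
    rw [← key]
    intro x hx
    rw [Submodule.mem_orthogonal] at hx
    rw [← Submodule.iInf_orthogonal, Submodule.mem_iInf]
    intro μ
    rw [Submodule.mem_orthogonal]
    intro u hu
    have h3 := ((B μ).hasSum_repr ⟨u, hu⟩).mapL ((innerSL ℝ x).comp (V μ).subtypeL)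
    have h4 : ∀ i, inner ℝ x ((B μ i : V μ) : H) = 0 := fun i => by
      rw [real_inner_comm]
      exact hx _ (Submodule.subset_span ⟨⟨μ, i⟩, rfl⟩)
    have h6 : (fun i => ((innerSL ℝ x).comp (V μ).subtypeL) ((B μ).repr ⟨u, hu⟩ i • B μ i)) =
        fun _ => 0 := by
      funext i
      simp [h4]
    rw [h6] at h3
    rw [real_inner_comm]
    simpa using h3.unique hasSum_zero
  refine ⟨_, HilbertBasis.mkOfOrthogonalEqBot hv hbot, fun a => a.1, fun a => ?_⟩
  rw [HilbertBasis.coe_mkOfOrthogonalEqBot]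
  exact (hVmem _ _).1 (B a.1 a.2 : V a.1).2

end Spectral

namespace TripleOperator

variable (A : TripleOperator)

/-- An operator `A` as above has an orthonormal basis of eigenvectors. -/
theorem exists_eigenbasis : ∃ (ι : Type) (b : HilbertBasis ι ℝ RealL2) (l : ι → ℝ),
    ∀ i, ∃ h : b i ∈ A.op.domain, A.op ⟨b i, h⟩ = l i • b i := by
  obtain ⟨K, hr, -, ι₀, b₀, hb₀⟩ := A.hilbertSchmidt_inverse
  have hsymm : (K : RealL2 →ₗ[ℝ] RealL2).IsSymmetric := by
    intro x y
    obtain ⟨hx, hx'⟩ := hr x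
    obtain ⟨hy, hy'⟩ := hr y
    have hf := LinearPMap.adjoint_isFormalAdjoint A.selfAdjoint.dense_domain
    rw [LinearPMap.isSelfAdjoint_def.1 A.selfAdjoint] at hf
    have := hf ⟨K x, hx⟩ ⟨K y, hy⟩
    rw [hx', hy'] at this
    exact this.symm
  obtain ⟨ι, b, c, hb⟩ :=
    exists_hilbertBasis_eigenvectors K (isCompactOperator_of_summable b₀ K hb₀) hsymm
  refine ⟨ι, b, fun i => (c i)⁻¹, fun i => ?_⟩
  obtain ⟨h, h'⟩ := hr (b i)
  have hc : c i ≠ 0 := by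
    intro h0
    have hK : K (b i) = 0 := by rw [hb, h0, zero_smul]
    have : (⟨K (b i), h⟩ : A.op.domain) = 0 := Subtype.ext hK
    rw [this, LinearPMap.map_zero] at h'
    exact b.orthonormal.ne_zero i h'.symm
  have hbi : b i = (c i)⁻¹ • K (b i) := by rw [hb, smul_smul, inv_mul_cancel₀ hc, one_smul]
  have hmem : b i ∈ A.op.domain := by rw [hbi]; exact A.op.domain.smul_mem _ h
  refine ⟨hmem, ?_⟩
  have : (⟨b i, hmem⟩ : A.op.domain) = (c i)⁻¹ • ⟨K (b i), h⟩ := Subtype.ext hbi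
  rw [this, LinearPMap.map_smul, h']

/-- The index set of the eigenbasis of `A`. -/
def Idx : Type := A.exists_eigenbasis.choose

/-- An orthonormal basis `(e_j)` of `L²(ℝ, dt)` of eigenvectors of `A`. -/
def eigenbasis : HilbertBasis A.Idx ℝ RealL2 := A.exists_eigenbasis.choose_spec.choose

/-- The eigenvalues `λ_j` of `A`, `A e_j = λ_j e_j`. -/
def eigenvalue : A.Idx → ℝ := A.exists_eigenbasis.choose_spec.choose_spec.choose

theorem op_eigenbasis (j : A.Idx) : ∃ h : A.eigenbasis j ∈ A.op.domain,
    A.op ⟨A.eigenbasis j, h⟩ = A.eigenvalue j • A.eigenbasis j :=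
  A.exists_eigenbasis.choose_spec.choose_spec.choose_spec j

/-- The basis vector `e_j`, as an element of `L²(ℝ, ℂ, dt)`. -/
def eigenvec (j : A.Idx) : ComplexL2 := Complex.ofRealCLM.compLp (A.eigenbasis j)

end TripleOperator

/-! ### The space `E_ℂ` -/

/-- The canonical `ℂ`-bilinear form `⟨ξ, η⟩ = ∫ ξ η dt` on `L²(ℝ, ℂ, dt)`, as a continuous linear
form in `η`. -/
def bilin (ξ : ComplexL2) : ComplexL2 →L[ℂ] ℂ := innerSL ℂ (star ξ)

theorem bilin_apply (ξ η : ComplexL2) : bilin ξ η = ∫ t, ξ t * η t := by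
  simp only [bilin, innerSL_apply_apply, L2.inner_def]
  refine integral_congr_ae ?_
  filter_upwards [Lp.coeFn_star ξ] with t ht
  simp [ht, mul_comm]

variable (A : TripleOperator)

/-- `|ξ|_p² = |A^p ξ|_0² = ∑_j λ_j^{2p} |⟨ξ, e_j⟩|²`, for `p ∈ ℝ`. -/
def vecNormSq (p : ℝ) (ξ : ComplexL2) : ℝ≥0∞ :=
  ∑' j, ENNReal.ofReal (A.eigenvalue j ^ (2 * p)) * ‖bilin ξ (A.eigenvec j)‖ₑ ^ 2

/-- `E_ℂ`, the complexification of `E = ⋂_p D(A^p)`. -/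
def EC : Set ComplexL2 := {ξ | ∀ p : ℝ, vecNormSq A p ξ < ∞}

/-! ### The space of test functions `(E)_β` -/

/-- A Hilbert-Schmidt tensor `f` of order `n` over `L²(ℝ, ℂ, dt)` is given by the continuous
`n`-linear form `(x₁, …, xₙ) ↦ ⟨f, x₁ ⊗ ⋯ ⊗ xₙ⟩`. -/
abbrev Tensor (n : ℕ) : Type := ContinuousMultilinearMap ℂ (fun _ : Fin n => ComplexL2) ℂ

/-- `|f|_p² = |(A^{⊗n})^p f|_0² = ∑_J λ_{J₁}^{2p} ⋯ λ_{Jₙ}^{2p} |⟨f, e_{J₁} ⊗ ⋯ ⊗ e_{Jₙ}⟩|²`. -/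
def tensorNormSq (p : ℝ) {n : ℕ} (f : Tensor n) : ℝ≥0∞ :=
  ∑' J : Fin n → A.Idx, (∏ i, ENNReal.ofReal (A.eigenvalue (J i) ^ (2 * p))) *
    ‖f fun i => A.eigenvec (J i)‖ₑ ^ 2

/-- `|Φ|_{p,β} = (∑ₙ (n!)^{1+β} |fₙ|_p²)^{1/2}` for `Φ ∼ (fₙ)`. -/
def fockNorm (β p : ℝ) (f : ∀ n, Tensor n) : ℝ≥0∞ :=
  (∑' n, ENNReal.ofReal ((n.factorial : ℝ) ^ (1 + β)) * tensorNormSq A p (f n)) ^ (1 / 2 : ℝ)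

theorem fockNorm_eq_lintegral (β p : ℝ) (f : ∀ n, Tensor n) :
    letI : MeasurableSpace (Σ n, Fin n → A.Idx) := ⊤
    fockNorm A β p f = (∫⁻ a, ((ENNReal.ofReal ((a.1.factorial : ℝ) ^ (1 + β)) *
      ∏ i, ENNReal.ofReal (A.eigenvalue (a.2 i) ^ (2 * p))) ^ (1 / 2 : ℝ) *
      ‖f a.1 fun i => A.eigenvec (a.2 i)‖ₑ) ^ (2 : ℝ)
        ∂(Measure.count : Measure (Σ n, Fin n → A.Idx))) ^ (1 / 2 : ℝ) := by
  let _ : MeasurableSpace (Σ n, Fin n → A.Idx) := ⊤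
  have : MeasurableSingletonClass (Σ n, Fin n → A.Idx) := ⟨fun _ => trivial⟩
  rw [lintegral_count, ENNReal.tsum_sigma']
  simp only [fockNorm, tensorNormSq, ← ENNReal.tsum_mul_left]
  congr 1
  refine tsum_congr fun n => tsum_congr fun J => ?_
  rw [ENNReal.mul_rpow_of_nonneg _ _ (by norm_num), ← ENNReal.rpow_mul]
  norm_num [mul_assoc]

theorem fockNorm_add_le (β p : ℝ) (f g : ∀ n, Tensor n) :
    fockNorm A β p (f + g) ≤ fockNorm A β p f + fockNorm A β p g := by
  let _ : MeasurableSpace (Σ n, Fin n → A.Idx) := ⊤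
  simp only [fockNorm_eq_lintegral]
  refine le_trans ?_ (ENNReal.lintegral_Lp_add_le (p := 2) (μ := Measure.count)
    measurable_from_top.aemeasurable measurable_from_top.aemeasurable (by norm_num))
  gcongr with a
  simp only [Pi.add_apply, add_apply, ← mul_add]
  gcongr
  exact enorm_add_le _ _

theorem fockNorm_smul (β p : ℝ) (c : ℂ) (f : ∀ n, Tensor n) :
    fockNorm A β p (c • f) = ‖c‖ₑ * fockNorm A β p f := by
  have h : ‖c‖ₑ = (‖c‖ₑ ^ 2) ^ (1 / 2 : ℝ) := by
    rw [← ENNReal.rpow_natCast, ← ENNReal.rpow_mul]; norm_num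
  rw [h, fockNorm, fockNorm, ← ENNReal.mul_rpow_of_nonneg _ _ (by norm_num), ← ENNReal.tsum_mul_left]
  congr 1
  refine tsum_congr fun n => ?_
  rw [tensorNormSq, tensorNormSq, mul_left_comm, ← ENNReal.tsum_mul_left (a := ‖c‖ₑ ^ 2)]
  congr 1
  refine tsum_congr fun J => ?_
  simp only [Pi.smul_apply, smul_apply, smul_eq_mul, enorm_mul, mul_pow]
  ring

/-- The space `(E)_β`, given through the Wiener-Itô chaos decomposition: the sequences `(fₙ)` of
symmetric tensors such that `|(fₙ)|_{p,β} < ∞` for all `p ∈ ℝ`. -/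
def testSubmodule (β : ℝ) : Submodule ℂ (∀ n, Tensor n) where
  carrier := {f | (∀ n (σ : Equiv.Perm (Fin n)) (x : Fin n → ComplexL2), f n (x ∘ σ) = f n x) ∧
    ∀ p : ℝ, fockNorm A β p f < ∞}
  add_mem' := by
    rintro f g ⟨hf, hf'⟩ ⟨hg, hg'⟩
    refine ⟨fun n σ x => ?_, fun p => (fockNorm_add_le A β p f g).trans_lt
      (ENNReal.add_lt_top.2 ⟨hf' p, hg' p⟩)⟩
    simp only [Pi.add_apply, add_apply, hf n σ x, hg n σ x]
  zero_mem' := by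
    refine ⟨fun n σ x => rfl, fun p => ?_⟩
    simp [fockNorm, tensorNormSq]
  smul_mem' := by
    rintro c f ⟨hf, hf'⟩
    refine ⟨fun n σ x => ?_, fun p => ?_⟩
    · simp only [Pi.smul_apply, smul_apply, hf n σ x]
    · rw [fockNorm_smul]
      exact ENNReal.mul_lt_top enorm_lt_top (hf' p)

/-- The space `(E)_β`, as a type of its own (it does not carry the topology of the product). -/
def TestSpace (β : ℝ) : Type := testSubmodule A β

instance (β : ℝ) : AddCommGroup (TestSpace A β) := inferInstanceAs (AddCommGroup (testSubmodule A β))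

instance (β : ℝ) : Module ℂ (TestSpace A β) := inferInstanceAs (Module ℂ (testSubmodule A β))

/-- The norm `|·|_{p,β}` on `(E)_β`. -/
def testNorm (β p : ℝ) : Seminorm ℂ (TestSpace A β) :=
  Seminorm.of (fun f => (fockNorm A β p f.1).toReal)
    (fun f g => by
      rw [← ENNReal.toReal_add (f.2.2 p).ne (g.2.2 p).ne]
      exact ENNReal.toReal_mono (ENNReal.add_ne_top.2 ⟨(f.2.2 p).ne, (g.2.2 p).ne⟩)
        (fockNorm_add_le A β p f.1 g.1))
    (fun c f => by
      change (fockNorm A β p (c • f.1)).toReal = _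
      rw [fockNorm_smul, ENNReal.toReal_mul, toReal_enorm])

/-- The family of norms `|·|_{p,β}`, `p ∈ ℝ`. -/
def testNorms (β : ℝ) : SeminormFamily ℂ (TestSpace A β) ℝ := testNorm A β

/-- The topology of `(E)_β`: the projective limit topology, defined by the norms `|·|_{p,β}`. -/
instance testTopology (β : ℝ) : TopologicalSpace (TestSpace A β) :=
  (testNorms A β).moduleFilterBasis.topology

theorem testSpace_withSeminorms (β : ℝ) : WithSeminorms (testNorms A β) := ⟨rfl⟩

instance (β : ℝ) : IsTopologicalAddGroup (TestSpace A β) :=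
  (testSpace_withSeminorms A β).topologicalAddGroup

instance (β : ℝ) : ContinuousSMul ℂ (TestSpace A β) :=
  (testSpace_withSeminorms A β).continuousSMul

/-- The space `(E)_β*` of generalized functions: the dual of `(E)_β` with the strong topology. -/
abbrev Distributions (β : ℝ) : Type := StrongDual ℂ (TestSpace A β)

/-! ### Exponential vectors, `S`-transform, Wick product -/

/-- The chaos decomposition `(ξ^{⊗n} / n!)ₙ` of the exponential vector `Φ_ξ`. -/
def expCoeff (ξ : ComplexL2) (n : ℕ) : Tensor n :=
  (n.factorial : ℂ)⁻¹ •
    (ContinuousMultilinearMap.mkPiAlgebra ℂ (Fin n) ℂ).compContinuousLinearMap fun _ => bilin ξ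

theorem expCoeff_apply (ξ : ComplexL2) (n : ℕ) (x : Fin n → ComplexL2) :
    expCoeff ξ n x = (n.factorial : ℂ)⁻¹ * ∏ i, bilin ξ (x i) := by
  simp [expCoeff]

theorem tsum_prod_pi {ι : Type} (a : ι → ℝ≥0∞) (n : ℕ) :
    ∑' J : Fin n → ι, ∏ i, a (J i) = (∑' j, a j) ^ n := by
  induction n with
  | zero => simp
  | succ n ih =>
    rw [← (Fin.consEquiv fun _ : Fin (n + 1) => ι).tsum_eq, ENNReal.tsum_prod', pow_succ',
      ← ENNReal.tsum_mul_right]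
    refine tsum_congr fun j => ?_
    rw [← ih, ← ENNReal.tsum_mul_left]
    refine tsum_congr fun J => ?_
    simp [Fin.prod_univ_succ, Fin.consEquiv]

theorem tensorNormSq_expCoeff (p : ℝ) (ξ : ComplexL2) (n : ℕ) :
    tensorNormSq A p (expCoeff ξ n) =
      ‖(n.factorial : ℂ)⁻¹‖ₑ ^ 2 * vecNormSq A p ξ ^ n := by
  rw [vecNormSq, ← tsum_prod_pi, tensorNormSq, ← ENNReal.tsum_mul_left]
  refine tsum_congr fun J => ?_
  have h : ‖∏ i, bilin ξ (A.eigenvec (J i))‖ₑ = ∏ i, ‖bilin ξ (A.eigenvec (J i))‖ₑ := by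
    simp only [← ofReal_norm, norm_prod]
    exact ENNReal.ofReal_prod_of_nonneg fun i _ => norm_nonneg _
  rw [expCoeff_apply, enorm_mul, mul_pow, Finset.prod_mul_distrib, Finset.prod_pow, h]
  ring

theorem summable_pow_mul_factorial_rpow {β : ℝ} (hβ : β < 1) (r : ℝ) (hr : 0 ≤ r) :
    Summable fun n : ℕ => r ^ n * (n.factorial : ℝ) ^ (β - 1) := by
  rcases hr.eq_or_lt with rfl | hr
  · refine summable_of_ne_finset_zero (s := {0}) fun n hn => ?_
    simp [show n ≠ 0 by simpa using hn]
  refine summable_of_ratio_test_tendsto_lt_one (l := 0) one_pos ?_ ?_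
  · exact Filter.Eventually.of_forall fun n => by positivity
  · have h1 : Filter.Tendsto (fun n : ℕ => r * ((n : ℝ) + 1) ^ (-(1 - β))) Filter.atTop
        (nhds (r * 0)) :=
      ((tendsto_rpow_neg_atTop (sub_pos.2 hβ)).comp
        (Filter.tendsto_atTop_add_const_right _ _ tendsto_natCast_atTop_atTop)).const_mul r
    rw [mul_zero] at h1
    refine h1.congr fun n => ?_
    have hn : (0 : ℝ) < n.factorial := by positivity
    have h2 : (0 : ℝ) < (n.factorial : ℝ) ^ (β - 1) := by positivity
    rw [Real.norm_of_nonneg (by positivity), Real.norm_of_nonneg (by positivity),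
      Nat.factorial_succ, Nat.cast_mul, Real.mul_rpow (by positivity) hn.le, pow_succ, neg_sub]
    push_cast
    field_simp

theorem expCoeff_mem {β : ℝ} (hβ : β < 1) {ξ : ComplexL2} (hξ : ξ ∈ EC A) :
    expCoeff ξ ∈ testSubmodule A β := by
  refine ⟨fun n σ x => ?_, fun p => ?_⟩
  · simp only [expCoeff_apply, Function.comp_apply]
    rw [Equiv.prod_comp σ fun i => bilin ξ (x i)]
  · refine ENNReal.rpow_lt_top_of_nonneg (by norm_num) ?_
    have hs := summable_pow_mul_factorial_rpow hβ (vecNormSq A p ξ).toReal ENNReal.toReal_nonneg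
    refine (lt_of_le_of_lt (le_of_eq ?_) hs.tsum_ofReal_lt_top).ne
    refine tsum_congr fun n => ?_
    have hn : (0 : ℝ) < n.factorial := by positivity
    rw [tensorNormSq_expCoeff, ← ofReal_norm, ← ENNReal.ofReal_pow (norm_nonneg _), ← mul_assoc,
      ← ENNReal.ofReal_mul (by positivity), mul_comm,
      ENNReal.ofReal_mul (p := (vecNormSq A p ξ).toReal ^ n) (by positivity),
      ENNReal.ofReal_pow ENNReal.toReal_nonneg, ENNReal.ofReal_toReal (hξ p).ne]
    congr 2
    rw [norm_inv, Complex.norm_natCast, ← Real.rpow_natCast, ← Real.rpow_neg_one,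
      ← Real.rpow_mul hn.le, ← Real.rpow_add hn]
    congr 1
    push_cast
    ring

/-- The exponential vector `Φ_ξ ∈ (E)_β`, for `ξ ∈ E_ℂ`. -/
def expVector {β : ℝ} (hβ : β < 1) (ξ : EC A) : TestSpace A β :=
  ⟨expCoeff ξ, expCoeff_mem A hβ ξ.2⟩

/-- The `S`-transform `S(Ψ)(ξ) = ⟪Ψ, Φ_ξ⟫`. -/
def sTransform {β : ℝ} (hβ : β < 1) (Ψ : Distributions A β) (ξ : EC A) : ℂ :=
  Ψ (expVector A hβ ξ)

/-- The Wick product `Ψ ⋄ Θ = S⁻¹(S(Ψ) S(Θ))`. -/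
def wick {β : ℝ} (hβ : β < 1) (Ψ Θ : Distributions A β) : Distributions A β :=
  Function.invFun (sTransform A hβ) fun ξ => sTransform A hβ Ψ ξ * sTransform A hβ Θ ξ

end WhiteNoise

end

/-!
A test function is determined by its coordinates at the products of eigenvectors of `A`, which are
indexed by multisets of eigenvectors. Since some power of `A⁻¹` is Hilbert–Schmidt with norm less
than one, the weighted `ℓ²` norms of the coordinates can be replaced by weighted suprema, so that
`(E)_β` is the space of all families of scalars bounded against every weight.

The convolution operator is `(C_φ f)_γ = φ (shift γ f)`, where `shift γ` is, up to a factor, the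
derivative of order `γ`. An exponential vector is a joint eigenvector of the shifts, hence
`C_φ Φ_ξ = S(φ)(ξ) Φ_ξ` and `S(ψ ∘ C_φ) = S(φ) S(ψ)`. On finite linear combinations of eigenvectors,
`S(φ)` is a power series whose coefficients are, up to factorials, the values of `φ` on the unit
vectors; so `S` is injective and `φ ⋄ ψ = ψ ∘ C_φ`. As `C_φ` followed by the vacuum expectation
is `φ`, the map `φ ↦ C_φ` has a continuous left inverse.
-/

noncomputable section

namespace WhiteNoise

section HilbertSpace

variable {𝕜 H H' ι ι' : Type*} [RCLike 𝕜] [NormedAddCommGroup H] [InnerProductSpace 𝕜 H]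
  [NormedAddCommGroup H'] [InnerProductSpace 𝕜 H']

theorem tsum_enorm_inner_sq (b : HilbertBasis ι 𝕜 H) (x : H) :
    ∑' i, ‖inner 𝕜 (b i) x‖ₑ ^ 2 = ‖x‖ₑ ^ 2 := by
  have hsum : HasSum (fun i => ‖inner 𝕜 (b i) x‖ ^ 2) (‖x‖ ^ 2) := by
    have h := (b.hasSum_inner_mul_inner x x).mapL RCLike.reCLM
    simpa only [RCLike.reCLM_apply, ← norm_sq_eq_re_inner, inner_mul_symm_re_eq_norm, norm_mul,
      norm_inner_symm x, ← sq] using h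
  simp only [← ofReal_norm, ← ENNReal.ofReal_pow (norm_nonneg _)]
  rw [← hsum.tsum_eq, ENNReal.ofReal_tsum_of_nonneg (fun i => by positivity) hsum.summable]

theorem tsum_enorm_apply_sq_eq_tsum_adjoint [CompleteSpace H] [CompleteSpace H']
    (b : HilbertBasis ι 𝕜 H) (b' : HilbertBasis ι' 𝕜 H') (K : H →L[𝕜] H') :
    ∑' i, ‖K (b i)‖ₑ ^ 2 = ∑' i, ‖K.adjoint (b' i)‖ₑ ^ 2 := by
  have hsymm : ∀ i j, ‖inner 𝕜 (b' j) (K (b i))‖ₑ = ‖inner 𝕜 (b i) (K.adjoint (b' j))‖ₑ :=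
    fun i j => by
      rw [ContinuousLinearMap.adjoint_inner_right, ← enorm_norm, norm_inner_symm, enorm_norm]
  simp only [← tsum_enorm_inner_sq b', ← tsum_enorm_inner_sq b (K.adjoint _), hsymm]
  exact ENNReal.tsum_comm

theorem isSymmetric_of_isSelfAdjoint_of_rightInverse [CompleteSpace H] {A : H →ₗ.[𝕜] H}
    (hA : IsSelfAdjoint A) {K : H →ₗ[𝕜] H}
    (hK : ∀ y, ∃ h : K y ∈ A.domain, A ⟨K y, h⟩ = y) : K.IsSymmetric := by
  intro x y
  obtain ⟨hx, hAx⟩ := hK x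
  obtain ⟨hy, hAy⟩ := hK y
  have hformal := LinearPMap.adjoint_isFormalAdjoint hA.dense_domain
  rw [LinearPMap.isSelfAdjoint_def.1 hA] at hformal
  simpa only [hAx, hAy] using (hformal ⟨K x, hx⟩ ⟨K y, hy⟩).symm

end HilbertSpace

section ComplexLp

variable {α : Type*} [MeasurableSpace α] {p : ℝ≥0∞} {μ : Measure α}

theorem ofReal_compLp_re_add_I_smul_ofReal_compLp_im (f : Lp ℂ p μ) :
    Complex.ofRealCLM.compLp (Complex.reCLM.compLp f) +
      Complex.I • Complex.ofRealCLM.compLp (Complex.imCLM.compLp f) = f := by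
  refine Lp.ext ?_
  filter_upwards [
    Lp.coeFn_add (Complex.ofRealCLM.compLp (Complex.reCLM.compLp f))
      (Complex.I • Complex.ofRealCLM.compLp (Complex.imCLM.compLp f)),
    Lp.coeFn_smul Complex.I (Complex.ofRealCLM.compLp (Complex.imCLM.compLp f)),
    Complex.ofRealCLM.coeFn_compLp (Complex.reCLM.compLp f),
    Complex.ofRealCLM.coeFn_compLp (Complex.imCLM.compLp f),
    Complex.reCLM.coeFn_compLp f, Complex.imCLM.coeFn_compLp f]
    with t h_add h_smul h_ofReal_re h_ofReal_im h_re h_im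
  rw [h_add, Pi.add_apply, h_smul, Pi.smul_apply, h_ofReal_re, h_ofReal_im, h_re, h_im]
  simp [mul_comm Complex.I]

theorem dense_span_ofReal_compLp [Fact (1 ≤ p)] {s : Set (Lp ℝ p μ)}
    (hs : Dense (Submodule.span ℝ s : Set (Lp ℝ p μ))) :
    Dense (Submodule.span ℂ ((fun f => Complex.ofRealCLM.compLp f) '' s) :
      Set (Lp ℂ p μ)) := by
  let L := Complex.ofRealCLM.compLpL p μ
  let V := Submodule.span ℂ (L '' s)
  have hspan : Submodule.span ℝ s ≤ (V.restrictScalars ℝ).comap L.toLinearMap :=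
    Submodule.span_le.2 fun f hf => Submodule.subset_span ⟨f, hf, rfl⟩
  have hreal : ∀ f, L f ∈ V.topologicalClosure := fun f =>
    map_mem_closure L.continuous (hs f) hspan
  intro f
  rw [← ofReal_compLp_re_add_I_smul_ofReal_compLp_im f]
  exact V.topologicalClosure.add_mem (hreal _) (V.topologicalClosure.smul_mem _ (hreal _))

end ComplexLp

theorem multilinear_ext_of_dense_span {𝕜 ι G : Type*} {E : ι → Type*} [Finite ι]
    [Semiring 𝕜] [∀ i, AddCommMonoid (E i)] [∀ i, Module 𝕜 (E i)] [∀ i, TopologicalSpace (E i)]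
    [AddCommMonoid G] [Module 𝕜 G] [TopologicalSpace G] [T2Space G]
    {f g : ContinuousMultilinearMap 𝕜 E G} {s : ∀ i, Set (E i)}
    (hs : ∀ i, Dense (Submodule.span 𝕜 (s i) : Set (E i)))
    (h : ∀ x, (∀ i, x i ∈ s i) → f x = g x) : f = g := by
  classical
  have := Fintype.ofFinite ι
  -- Free the arguments from `s` one at a time: `t` collects those already arbitrary.
  have key : ∀ t : Finset ι, ∀ x : ∀ i, E i, (∀ i ∉ t, x i ∈ s i) → f x = g x := by
    intro t
    induction t using Finset.induction_on with
    | empty => exact fun x hx => h x fun i => hx i (Finset.notMem_empty i)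
    | insert a t ha ih =>
      intro x hx
      have hslice : f.toContinuousLinearMap x a = g.toContinuousLinearMap x a := by
        refine ContinuousLinearMap.ext_on (hs a) fun y hy => ih _ fun i hi => ?_
        rcases eq_or_ne i a with rfl | hia
        · simpa using hy
        · rw [Function.update_of_ne hia]
          exact hx i (by simp [hia, hi])
      simpa using DFunLike.congr_fun hslice (x a)
  exact ContinuousMultilinearMap.ext fun x => key Finset.univ x (by simp)

section Tuples

variable {ι : Type*} {n : ℕ}

/-- The multiset of the entries of a tuple. Symmetric tensors of order `n` have their coordinates
indexed by the multisets of cardinality `n`. -/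
def tupleMultiset (J : Fin n → ι) : Multiset ι := Finset.univ.val.map J

@[simp]
theorem card_tupleMultiset (J : Fin n → ι) : Multiset.card (tupleMultiset J) = n := by
  simp [tupleMultiset]

theorem prod_map_tupleMultiset {M : Type*} [CommMonoid M] (J : Fin n → ι) (g : ι → M) :
    ((tupleMultiset J).map g).prod = ∏ i, g (J i) := by
  rw [tupleMultiset, Multiset.map_map]
  rfl

theorem tupleMultiset_comp_perm (J : Fin n → ι) (σ : Equiv.Perm (Fin n)) :
    tupleMultiset (J ∘ σ) = tupleMultiset J := by
  rw [tupleMultiset, ← Multiset.map_map, Multiset.map_univ_val_equiv, tupleMultiset]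

theorem tupleMultiset_toList_get (α : Multiset ι) : tupleMultiset α.toList.get = α := by
  rw [tupleMultiset, Fin.univ_val_map, List.ofFn_get, Multiset.coe_toList]

theorem exists_perm_of_tupleMultiset_eq {J K : Fin n → ι}
    (h : tupleMultiset J = tupleMultiset K) : ∃ σ : Equiv.Perm (Fin n), J = K ∘ σ := by
  classical
  have hcard : ∀ v, Fintype.card {i // J i = v} = Fintype.card {i // K i = v} := fun v => by
    have hcount := congrArg (Multiset.count v) h
    simp only [tupleMultiset, Multiset.count_map, eq_comm (a := v)] at hcount
    rw [Fintype.card_subtype, Fintype.card_subtype]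
    exact hcount
  let fiberEquiv := fun v => Fintype.equivOfCardEq (hcard v)
  refine ⟨(Equiv.sigmaFiberEquiv J).symm.trans
    ((Equiv.sigmaCongrRight fiberEquiv).trans (Equiv.sigmaFiberEquiv K)), funext fun i => ?_⟩
  exact (fiberEquiv (J i) ⟨i, rfl⟩).2.symm

end Tuples

section PowerSeries

variable {𝕜 ι : Type*}

theorem eq_zero_of_hasSum_pow_smul [NontriviallyNormedField 𝕜] {E : Type*}
    [NormedAddCommGroup E] [NormedSpace 𝕜 E] {b : ℕ → E}
    (h : ∀ t : 𝕜, HasSum (fun n => t ^ n • b n) 0) (n : ℕ) : b n = 0 := by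
  let p : FormalMultilinearSeries 𝕜 𝕜 E := fun n =>
    ContinuousMultilinearMap.mkPiRing 𝕜 (Fin n) (b n)
  have hcoeff : ∀ n, p.coeff n = b n := fun n => by simp [p, FormalMultilinearSeries.coeff]
  have hp : HasFPowerSeriesAt (0 : 𝕜 → E) p 0 := by
    rw [hasFPowerSeriesAt_iff]
    exact Filter.Eventually.of_forall fun t => by simpa [hcoeff] using h t
  rw [← hcoeff, hp.eq_zero]
  rfl

theorem tsum_sym_eq_zero_of_hasSum [NontriviallyNormedField 𝕜] [CompleteSpace 𝕜]
    {c : Multiset ι → 𝕜} {z : ι → 𝕜}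
    (h : ∀ t : 𝕜, HasSum (fun α => c α * (α.map fun j => t * z j).prod) 0) (n : ℕ) :
    ∑' γ : Sym ι n, c γ * ((γ : Multiset ι).map z).prod = 0 := by
  have hgraded : ∀ t : 𝕜, HasSum (fun a : Σ n, Sym ι n =>
      t ^ a.1 • (c a.2 * ((a.2 : Multiset ι).map z).prod)) 0 := fun t => by
    let e : (Σ n, Sym ι n) ≃ Multiset ι := Equiv.sigmaFiberEquiv Multiset.card
    refine (e.hasSum_iff.2 (h t)).congr_fun fun a => ?_
    have hcard : Multiset.card (e a) = a.1 := a.2.2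
    rw [Function.comp_apply, Multiset.prod_map_mul, Multiset.map_const', Multiset.prod_replicate,
      hcard, smul_eq_mul, mul_left_comm]
    rfl
  refine eq_zero_of_hasSum_pow_smul (𝕜 := 𝕜)
    (b := fun n => ∑' γ : Sym ι n, c γ * ((γ : Multiset ι).map z).prod) (fun t => ?_) n
  refine (hgraded t).sigma fun m => ?_
  have hsum := (hgraded 1).summable.sigma_factor m
  simp only [one_pow, one_smul] at hsum
  exact hsum.hasSum.const_smul _

theorem eq_zero_of_sum_mul_prod_eq_zero [CommRing 𝕜] [IsDomain 𝕜] [Infinite 𝕜]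
    {Q : Finset (Multiset ι)} {c : Multiset ι → 𝕜}
    (h : ∀ z : ι → 𝕜, ∑ γ ∈ Q, c γ * (γ.map z).prod = 0) {α : Multiset ι} (hα : α ∈ Q) :
    c α = 0 := by
  classical
  have heval : ∀ (z : ι → 𝕜) (γ : Multiset ι), MvPolynomial.eval z
      (MvPolynomial.monomial (Multiset.toFinsupp γ) (c γ)) = c γ * (γ.map z).prod := by
    intro z γ
    rw [MvPolynomial.eval_monomial, Finset.prod_multiset_map_count, Finsupp.prod,
      Multiset.toFinsupp_support]
    simp only [Multiset.toFinsupp_apply]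
  have hpoly : ∑ γ ∈ Q, MvPolynomial.monomial (Multiset.toFinsupp γ) (c γ) = 0 :=
    MvPolynomial.funext fun z => by rw [map_sum, map_zero, ← h z]; simp only [heval]
  have hcoeff := congrArg (MvPolynomial.coeff (Multiset.toFinsupp α)) hpoly
  rw [MvPolynomial.coeff_sum, MvPolynomial.coeff_zero] at hcoeff
  simpa [MvPolynomial.coeff_monomial, hα] using hcoeff

theorem eq_zero_of_hasSum_mul_prod [NontriviallyNormedField 𝕜] [CompleteSpace 𝕜]
    {c : Multiset ι → 𝕜} (h : ∀ (T : Finset ι) (z : ι → 𝕜), (∀ j ∉ T, z j = 0) →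
      HasSum (fun α => c α * (α.map z).prod) 0) (α : Multiset ι) : c α = 0 := by
  classical
  have : Infinite 𝕜 := NontriviallyNormedField.infinite 𝕜
  let T := α.toFinset
  let n := Multiset.card α
  have hα : α ∈ (T.sym n).image fun γ : Sym ι n => (γ : Multiset ι) :=
    Finset.mem_image.2 ⟨⟨α, rfl⟩, Finset.mem_sym_iff.2 fun j => Multiset.mem_toFinset.2, rfl⟩
  refine eq_zero_of_sum_mul_prod_eq_zero (fun z => ?_) hα
  let zT : ι → 𝕜 := fun j => if j ∈ T then z j else 0
  have hzT : ∑' γ : Sym ι n, c γ * ((γ : Multiset ι).map zT).prod = 0 :=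
    tsum_sym_eq_zero_of_hasSum (fun t => h T _ fun j hj => by simp [zT, hj]) n
  have hout : ∀ γ : Sym ι n, γ ∉ T.sym n → c γ * ((γ : Multiset ι).map zT).prod = 0 := by
    intro γ hγ
    obtain ⟨j, hjγ, hjT⟩ : ∃ j ∈ γ, j ∉ T := by simpa [Finset.mem_sym_iff] using hγ
    have hzero : ((γ : Multiset ι).map zT).prod = 0 :=
      Multiset.prod_eq_zero (Multiset.mem_map.2 ⟨j, hjγ, if_neg hjT⟩)
    rw [hzero, mul_zero]
  rw [Finset.sum_image Sym.coe_injective.injOn, ← hzT, tsum_eq_sum hout]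
  refine Finset.sum_congr rfl fun γ hγ => ?_
  have hmap : (γ : Multiset ι).map z = (γ : Multiset ι).map zT :=
    Multiset.map_congr rfl fun j hj => (if_pos (Finset.mem_sym_iff.1 hγ j hj)).symm
  rw [hmap]

end PowerSeries

/-! ### Eigenvalues and eigenvectors -/

namespace TripleOperator

variable (A : TripleOperator)

theorem eigenvalue_mem_opSpectrum (j : A.Idx) : A.eigenvalue j ∈ opSpectrum A.op := by
  obtain ⟨hj, heig⟩ := A.op_eigenbasis j
  intro hbij
  have hzero : (⟨A.eigenbasis j, hj⟩ : A.op.domain) = 0 := hbij.injective (by simp [heig])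
  exact A.eigenbasis.orthonormal.ne_zero j (congrArg Subtype.val hzero)

theorem exists_one_lt_le_eigenvalue : ∃ ρ : ℝ, 1 < ρ ∧ ∀ j, ρ ≤ A.eigenvalue j := by
  refine ⟨_, A.one_lt_inf_spectrum, fun j => csInf_le ?_ (A.eigenvalue_mem_opSpectrum j)⟩
  -- `sInf` of a set that is not bounded below has the junk value `0`.
  by_contra hbdd
  have := A.one_lt_inf_spectrum
  rw [Real.sInf_of_not_bddBelow hbdd] at this
  linarith

theorem one_lt_eigenvalue (j : A.Idx) : 1 < A.eigenvalue j := by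
  obtain ⟨ρ, hρ, hle⟩ := A.exists_one_lt_le_eigenvalue
  exact hρ.trans_le (hle j)

theorem eigenvalue_pos (j : A.Idx) : 0 < A.eigenvalue j :=
  zero_lt_one.trans (A.one_lt_eigenvalue j)

theorem apply_eigenbasis_of_leftInverse {K : RealL2 →ₗ[ℝ] RealL2}
    (hK : ∀ x : A.op.domain, K (A.op x) = x) (j : A.Idx) :
    K (A.eigenbasis j) = (A.eigenvalue j)⁻¹ • A.eigenbasis j := by
  obtain ⟨hj, heig⟩ := A.op_eigenbasis j
  rw [eq_inv_smul_iff₀ (A.eigenvalue_pos j).ne', ← map_smul, ← heig]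
  exact hK ⟨_, hj⟩

theorem tsum_eigenvalue_rpow_neg_two_lt_top :
    ∑' j, ENNReal.ofReal (A.eigenvalue j ^ (-2 : ℝ)) < ∞ := by
  obtain ⟨K, hright, hleft, ι₀, b₀, hHS⟩ := A.hilbertSchmidt_inverse
  have hadj : K.adjoint = K := ((ContinuousLinearMap.eq_adjoint_iff _ _).2
    (isSymmetric_of_isSelfAdjoint_of_rightInverse A.selfAdjoint hright)).symm
  have hK : ∀ j, ENNReal.ofReal (A.eigenvalue j ^ (-2 : ℝ)) = ‖K (A.eigenbasis j)‖ₑ ^ 2 := by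
    intro j
    have hj := A.eigenvalue_pos j
    rw [← ContinuousLinearMap.coe_coe, A.apply_eigenbasis_of_leftInverse hleft, ← ofReal_norm,
      ← ENNReal.ofReal_pow (norm_nonneg _), norm_smul, A.eigenbasis.orthonormal.1 j, mul_one,
      Real.norm_of_nonneg (by positivity), inv_pow, Real.rpow_neg hj.le, Real.rpow_two]
  calc ∑' j, ENNReal.ofReal (A.eigenvalue j ^ (-2 : ℝ))
      = ∑' i, ENNReal.ofReal (‖K (b₀ i)‖ ^ 2) := by
        simp only [hK, tsum_enorm_apply_sq_eq_tsum_adjoint A.eigenbasis b₀, hadj,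
          ENNReal.ofReal_pow (norm_nonneg _), ofReal_norm]
    _ < ∞ := hHS.tsum_ofReal_lt_top

theorem exists_tsum_eigenvalue_rpow_le :
    ∃ s : ℝ, ∑' j, ENNReal.ofReal (A.eigenvalue j ^ (-(2 * s))) ≤ 2⁻¹ := by
  obtain ⟨ρ, hρ, hle⟩ := A.exists_one_lt_le_eigenvalue
  have hfin := A.tsum_eigenvalue_rpow_neg_two_lt_top
  set S := ∑' j, ENNReal.ofReal (A.eigenvalue j ^ (-2 : ℝ)) with hS
  obtain ⟨n, hn⟩ := pow_unbounded_of_one_lt (2 * S.toReal) hρ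
  have hρn : 0 < ρ ^ n := by positivity
  refine ⟨1 + n / 2, ?_⟩
  have hterm : ∀ j, ENNReal.ofReal (A.eigenvalue j ^ (-(2 * (1 + n / 2 : ℝ)))) ≤
      ENNReal.ofReal (ρ ^ n)⁻¹ * ENNReal.ofReal (A.eigenvalue j ^ (-2 : ℝ)) := fun j => by
    have hj := A.eigenvalue_pos j
    rw [← ENNReal.ofReal_mul (by positivity), show -(2 * (1 + n / 2 : ℝ)) = -n + -2 by ring,
      Real.rpow_add hj, Real.rpow_neg hj.le, Real.rpow_natCast]
    gcongr
    exact hle j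
  calc ∑' j, ENNReal.ofReal (A.eigenvalue j ^ (-(2 * (1 + n / 2 : ℝ))))
      ≤ ENNReal.ofReal (ρ ^ n)⁻¹ * S := by
        rw [hS, ← ENNReal.tsum_mul_left]
        exact ENNReal.tsum_le_tsum hterm
    _ = ENNReal.ofReal ((ρ ^ n)⁻¹ * S.toReal) := by
        rw [ENNReal.ofReal_mul (by positivity), ENNReal.ofReal_toReal hfin.ne]
    _ ≤ ENNReal.ofReal 2⁻¹ := by
        refine ENNReal.ofReal_le_ofReal ?_
        rw [inv_mul_le_iff₀ hρn]
        linarith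
    _ = 2⁻¹ := by rw [ENNReal.ofReal_inv_of_pos two_pos, ENNReal.ofReal_ofNat]

/-- An exponent `s` with `∑_j λ_j^{-2s} ≤ 1/2`: raising the exponent `p` of a weight by `s` turns
a uniform bound on coordinates into a bound on the norm `|·|_{p,β}`. -/
def gap : ℝ := A.exists_tsum_eigenvalue_rpow_le.choose

theorem tsum_eigenvalue_rpow_gap_le :
    ∑' j, ENNReal.ofReal (A.eigenvalue j ^ (-(2 * A.gap))) ≤ 2⁻¹ :=
  A.exists_tsum_eigenvalue_rpow_le.choose_spec

theorem two_le_eigenvalue_rpow_gap (j : A.Idx) : 2 ≤ A.eigenvalue j ^ (2 * A.gap) := by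
  have hpos := Real.rpow_pos_of_pos (A.eigenvalue_pos j) (2 * A.gap)
  have hj := (ENNReal.le_tsum j).trans A.tsum_eigenvalue_rpow_gap_le
  rw [Real.rpow_neg (A.eigenvalue_pos j).le, ENNReal.ofReal_inv_of_pos hpos,
    ENNReal.inv_le_inv, ← ENNReal.ofReal_ofNat, ENNReal.ofReal_le_ofReal_iff hpos.le] at hj
  exact hj

theorem star_eigenvec (j : A.Idx) : star (A.eigenvec j) = A.eigenvec j := by
  refine Lp.ext ?_
  filter_upwards [Lp.coeFn_star (A.eigenvec j),
    Complex.ofRealCLM.coeFn_compLp (A.eigenbasis j)] with t hstar hreal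
  rw [hstar, Pi.star_apply, eigenvec, hreal]
  simp

theorem bilin_eigenvec [DecidableEq A.Idx] (i j : A.Idx) :
    bilin (A.eigenvec i) (A.eigenvec j) = if i = j then 1 else 0 := by
  have hreal : (fun t => A.eigenvec i t * A.eigenvec j t) =ᵐ[volume]
      fun t => ((inner ℝ (A.eigenbasis i t) (A.eigenbasis j t) : ℝ) : ℂ) := by
    filter_upwards [Complex.ofRealCLM.coeFn_compLp (A.eigenbasis i),
      Complex.ofRealCLM.coeFn_compLp (A.eigenbasis j)] with t hi hj
    simp [eigenvec, hi, hj, mul_comm]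
  rw [bilin_apply, integral_congr_ae hreal, integral_complex_ofReal, ← L2.inner_def,
    orthonormal_iff_ite.1 A.eigenbasis.orthonormal i j]
  split_ifs <;> simp

theorem norm_bilin_eigenvec (j : A.Idx) : ‖bilin (A.eigenvec j)‖ = 1 := by
  classical
  have hself : inner ℂ (A.eigenvec j) (A.eigenvec j) = 1 := by
    simpa [bilin, A.star_eigenvec] using A.bilin_eigenvec j j
  rw [bilin, innerSL_apply_norm, A.star_eigenvec, norm_eq_sqrt_re_inner (𝕜 := ℂ), hself]
  simp

theorem dense_span_eigenvec :
    Dense (Submodule.span ℂ (Set.range A.eigenvec) : Set ComplexL2) := by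
  have hdense := dense_span_ofReal_compLp
    (Submodule.dense_iff_topologicalClosure_eq_top.2 A.eigenbasis.dense_span)
  rwa [← Set.range_comp] at hdense

theorem tensor_ext {n : ℕ} {f g : Tensor n}
    (h : ∀ J : Fin n → A.Idx, (f fun i => A.eigenvec (J i)) = g fun i => A.eigenvec (J i)) :
    f = g := by
  refine multilinear_ext_of_dense_span (fun _ => A.dense_span_eigenvec) fun x hx => ?_
  choose J hJ using hx
  rw [← funext hJ]
  exact h J

end TripleOperator

/-! ### Test functions as a sequence space -/

/-- The eigenvalue `λ^{pα} = ∏_{j ∈ α} λ_j^p` of `(A^{⊗n})^p`, `n = |α|`, at the product of the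
eigenvectors `e_j`, `j ∈ α`. -/
def eigenvalueProd (A : TripleOperator) (p : ℝ) (α : Multiset A.Idx) : ℝ :=
  (α.map fun j => A.eigenvalue j ^ p).prod

/-- The weight `(|α|!)^{(1+β)/2} λ^{pα}` with which the coordinate at `α` enters `|·|_{p,β}`. -/
def weight (A : TripleOperator) (β p : ℝ) (α : Multiset A.Idx) : ℝ :=
  ((Multiset.card α).factorial : ℝ) ^ ((1 + β) / 2) * eigenvalueProd A p α

variable {A : TripleOperator} {β : ℝ}

theorem eigenvalueProd_tupleMultiset (p : ℝ) {n : ℕ} (J : Fin n → A.Idx) :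
    eigenvalueProd A p (tupleMultiset J) = ∏ i, A.eigenvalue (J i) ^ p :=
  prod_map_tupleMultiset J fun j => A.eigenvalue j ^ p

theorem eigenvalueProd_pos (p : ℝ) (α : Multiset A.Idx) : 0 < eigenvalueProd A p α := by
  refine Multiset.prod_pos fun x hx => ?_
  obtain ⟨j, -, rfl⟩ := Multiset.mem_map.1 hx
  exact Real.rpow_pos_of_pos (A.eigenvalue_pos j) p

theorem eigenvalueProd_add (p q : ℝ) (α : Multiset A.Idx) :
    eigenvalueProd A (p + q) α = eigenvalueProd A p α * eigenvalueProd A q α := by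
  simp only [eigenvalueProd, ← Multiset.prod_map_mul, Real.rpow_add (A.eigenvalue_pos _)]

theorem eigenvalueProd_mul (p t : ℝ) (α : Multiset A.Idx) :
    eigenvalueProd A (p * t) α = eigenvalueProd A p α ^ t := by
  simp only [eigenvalueProd, Real.rpow_mul (A.eigenvalue_pos _).le]
  exact Real.multiset_prod_map_rpow α _
    (fun j _ => Real.rpow_nonneg (A.eigenvalue_pos j).le p) t

theorem eigenvalueProd_neg (p : ℝ) (α : Multiset A.Idx) :
    eigenvalueProd A (-p) α = (eigenvalueProd A p α)⁻¹ := by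
  rw [← mul_neg_one, eigenvalueProd_mul, Real.rpow_neg_one]

theorem eigenvalueProd_mono {p q : ℝ} (h : p ≤ q) (α : Multiset A.Idx) :
    eigenvalueProd A p α ≤ eigenvalueProd A q α :=
  Multiset.prod_map_le_prod_map₀ _ _
    (fun j _ => Real.rpow_nonneg (A.eigenvalue_pos j).le p)
    (fun j _ => Real.rpow_le_rpow_of_exponent_le (A.one_lt_eigenvalue j).le h)

theorem two_pow_card_le_eigenvalueProd (α : Multiset A.Idx) :
    2 ^ Multiset.card α ≤ eigenvalueProd A (2 * A.gap) α := by
  have hconst : (α.map fun _ => (2 : ℝ)).prod = 2 ^ Multiset.card α := by simp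
  rw [← hconst]
  exact Multiset.prod_map_le_prod_map₀ _ _ (fun _ _ => zero_le_two)
    fun j _ => A.two_le_eigenvalue_rpow_gap j

theorem choose_rpow_le_eigenvalueProd {α : Multiset A.Idx} {k : ℕ} (hk : k ≤ Multiset.card α)
    (t : ℝ) :
    ((Multiset.card α).choose k : ℝ) ^ t ≤ eigenvalueProd A (2 * A.gap * |t|) α := by
  have hchoose : (1 : ℝ) ≤ (Multiset.card α).choose k := by
    exact_mod_cast Nat.succ_le_of_lt (Nat.choose_pos hk)
  calc ((Multiset.card α).choose k : ℝ) ^ t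
      ≤ ((Multiset.card α).choose k : ℝ) ^ |t| :=
        Real.rpow_le_rpow_of_exponent_le hchoose (le_abs_self t)
    _ ≤ eigenvalueProd A (2 * A.gap) α ^ |t| := by
        refine Real.rpow_le_rpow (Nat.cast_nonneg _)
          (le_trans ?_ (two_pow_card_le_eigenvalueProd α)) (abs_nonneg t)
        exact_mod_cast Nat.choose_le_two_pow _ _
    _ = eigenvalueProd A (2 * A.gap * |t|) α := (eigenvalueProd_mul _ _ _).symm

theorem weight_pos (p : ℝ) (α : Multiset A.Idx) : 0 < weight A β p α :=
  mul_pos (by positivity) (eigenvalueProd_pos p α)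

theorem weight_mono {p q : ℝ} (h : p ≤ q) (α : Multiset A.Idx) :
    weight A β p α ≤ weight A β q α :=
  mul_le_mul_of_nonneg_left (eigenvalueProd_mono h α) (by positivity)

theorem weight_add (p q : ℝ) (α : Multiset A.Idx) :
    weight A β (p + q) α = weight A β p α * eigenvalueProd A q α := by
  rw [weight, weight, eigenvalueProd_add, mul_assoc]

theorem weight_mul_weight_mul_choose (p : ℝ) (γ α : Multiset A.Idx) :
    weight A β p γ * weight A β p α * ((Multiset.card (α + γ)).choose (Multiset.card γ) : ℝ) =
      weight A β p (α + γ) *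
        ((Multiset.card (α + γ)).choose (Multiset.card γ) : ℝ) ^ ((1 - β) / 2) := by
  have hle : Multiset.card γ ≤ Multiset.card (α + γ) := by simp
  have hfact := Nat.choose_mul_factorial_mul_factorial hle
  rw [Multiset.card_add, Nat.add_sub_cancel, ← Multiset.card_add] at hfact
  have hchoose : (0 : ℝ) < (Multiset.card (α + γ)).choose (Multiset.card γ) := by
    exact_mod_cast Nat.choose_pos hle
  have hsplit : ((Multiset.card (α + γ)).choose (Multiset.card γ) : ℝ) ^ ((1 + β) / 2) *
      ((Multiset.card (α + γ)).choose (Multiset.card γ) : ℝ) ^ ((1 - β) / 2) =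
      (Multiset.card (α + γ)).choose (Multiset.card γ) := by
    rw [← Real.rpow_add hchoose, show (1 + β) / 2 + (1 - β) / 2 = 1 by ring, Real.rpow_one]
  have hprod : eigenvalueProd A p (α + γ) = eigenvalueProd A p α * eigenvalueProd A p γ := by
    simp only [eigenvalueProd, Multiset.map_add, Multiset.prod_add]
  simp only [weight, hprod, ← hfact, Nat.cast_mul]
  rw [Real.mul_rpow (by positivity) (by positivity), Real.mul_rpow hchoose.le (by positivity)]
  linear_combination
    -(((Multiset.card γ).factorial : ℝ) ^ ((1 + β) / 2) * eigenvalueProd A p γ *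
      (((Multiset.card α).factorial : ℝ) ^ ((1 + β) / 2) * eigenvalueProd A p α)) * hsplit

theorem weight_mul_weight_mul_choose_le (p : ℝ) (γ α : Multiset A.Idx) :
    weight A β p γ * weight A β p α * ((Multiset.card (α + γ)).choose (Multiset.card γ) : ℝ) ≤
      weight A β (p + A.gap * |1 - β|) (α + γ) := by
  have hchoose := choose_rpow_le_eigenvalueProd
    (show Multiset.card γ ≤ Multiset.card (α + γ) by simp) ((1 - β) / 2)
  rw [abs_div, abs_two, show 2 * A.gap * (|1 - β| / 2) = A.gap * |1 - β| by ring] at hchoose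
  rw [weight_mul_weight_mul_choose, weight_add]
  exact mul_le_mul_of_nonneg_left hchoose (weight_pos p _).le

theorem ofReal_weight_add_gap_sq_mul (p : ℝ) (α : Multiset A.Idx) :
    ENNReal.ofReal (weight A β (p + A.gap) α) ^ 2 *
      ENNReal.ofReal (eigenvalueProd A (-(2 * A.gap)) α) =
      ENNReal.ofReal (weight A β p α) ^ 2 := by
  have hgap := eigenvalueProd_pos A.gap α
  rw [← ENNReal.ofReal_pow (weight_pos _ _).le, ← ENNReal.ofReal_pow (weight_pos _ _).le,
    ← ENNReal.ofReal_mul (sq_nonneg _), weight_add, eigenvalueProd_neg, two_mul,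
    eigenvalueProd_add]
  congr 1
  field_simp

theorem ofReal_weight_tupleMultiset_sq (p : ℝ) {n : ℕ} (J : Fin n → A.Idx) :
    ENNReal.ofReal (weight A β p (tupleMultiset J)) ^ 2 =
      ENNReal.ofReal ((n.factorial : ℝ) ^ (1 + β)) *
        ∏ i, ENNReal.ofReal (A.eigenvalue (J i) ^ (2 * p)) := by
  rw [← ENNReal.ofReal_prod_of_nonneg fun _ _ => Real.rpow_nonneg (A.eigenvalue_pos _).le _,
    ← ENNReal.ofReal_mul (by positivity), ← ENNReal.ofReal_pow (weight_pos _ _).le,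
    ← eigenvalueProd_tupleMultiset, two_mul p, eigenvalueProd_add, weight, card_tupleMultiset,
    mul_pow, ← Real.rpow_natCast, ← Real.rpow_mul (Nat.cast_nonneg _), sq]
  congr 3
  push_cast
  ring

theorem tsum_eigenvalueProd_tupleMultiset_le (n : ℕ) :
    ∑' J : Fin n → A.Idx,
      ENNReal.ofReal (eigenvalueProd A (-(2 * A.gap)) (tupleMultiset J)) ≤ 2⁻¹ ^ n := by
  simp only [eigenvalueProd_tupleMultiset,
    ENNReal.ofReal_prod_of_nonneg fun _ _ => Real.rpow_nonneg (A.eigenvalue_pos _).le _]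
  rw [tsum_prod_pi fun j => ENNReal.ofReal (A.eigenvalue j ^ (-(2 * A.gap)))]
  exact pow_le_pow_left' A.tsum_eigenvalue_rpow_gap_le n

theorem tsum_tsum_eigenvalueProd_tupleMultiset_le :
    ∑' n, ∑' J : Fin n → A.Idx,
      ENNReal.ofReal (eigenvalueProd A (-(2 * A.gap)) (tupleMultiset J)) ≤ 2 :=
  (ENNReal.tsum_le_tsum tsum_eigenvalueProd_tupleMultiset_le).trans_eq <| by
    rw [ENNReal.tsum_geometric, ENNReal.one_sub_inv_two, inv_inv]

theorem summable_eigenvalueProd_tupleMultiset :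
    Summable fun a : Σ n, Fin n → A.Idx =>
      eigenvalueProd A (-(2 * A.gap)) (tupleMultiset a.2) := by
  have hfin : ∑' a : Σ n, Fin n → A.Idx,
      ENNReal.ofReal (eigenvalueProd A (-(2 * A.gap)) (tupleMultiset a.2)) ≠ ∞ := by
    rw [ENNReal.tsum_sigma']
    exact (tsum_tsum_eigenvalueProd_tupleMultiset_le.trans_lt ENNReal.ofNat_lt_top).ne
  exact (ENNReal.summable_toReal hfin).congr fun a =>
    ENNReal.toReal_ofReal (eigenvalueProd_pos _ _).le

theorem summable_eigenvalueProd :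
    Summable fun α : Multiset A.Idx => eigenvalueProd A (-(2 * A.gap)) α := by
  let toTuple : Multiset A.Idx → Σ n, Fin n → A.Idx := fun α => ⟨_, α.toList.get⟩
  have hinj : Function.Injective toTuple :=
    Function.LeftInverse.injective (g := fun a : Σ n, Fin n → A.Idx => tupleMultiset a.2)
      fun α => tupleMultiset_toList_get α
  exact (summable_eigenvalueProd_tupleMultiset.comp_injective hinj).congr fun α => by
    rw [Function.comp_apply, tupleMultiset_toList_get]

/-- The coordinate of a test function at `α`: the value of its chaos component of order `|α|` at
the eigenvectors `e_j`, `j ∈ α`, taken in any order. -/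
def coord (α : Multiset A.Idx) : TestSpace A β →ₗ[ℂ] ℂ where
  toFun f := f.1 α.toList.length fun i => A.eigenvec (α.toList.get i)
  map_add' _ _ := rfl
  map_smul' _ _ := rfl

theorem apply_eigenvec (f : TestSpace A β) {n : ℕ} (J : Fin n → A.Idx) :
    (f.1 n fun i => A.eigenvec (J i)) = coord (tupleMultiset J) f := by
  have key : ∀ m (K : Fin m → A.Idx), tupleMultiset J = tupleMultiset K →
      (f.1 n fun i => A.eigenvec (J i)) = f.1 m fun i => A.eigenvec (K i) := by
    intro m K h
    obtain rfl : n = m := by simpa using congrArg Multiset.card h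
    obtain ⟨σ, rfl⟩ := exists_perm_of_tupleMultiset_eq h
    exact f.2.1 n σ fun i => A.eigenvec (K i)
  exact key _ _ (tupleMultiset_toList_get _).symm

theorem ext_coord {f g : TestSpace A β} (h : ∀ α, coord α f = coord α g) : f = g :=
  Subtype.ext <| funext fun n => A.tensor_ext fun J => by
    rw [apply_eigenvec, apply_eigenvec, h]

theorem fockNorm_eq (p : ℝ) (f : ∀ n, Tensor n) : fockNorm A β p f =
    (∑' n, ∑' J : Fin n → A.Idx, (ENNReal.ofReal (weight A β p (tupleMultiset J)) *
      ‖f n fun i => A.eigenvec (J i)‖ₑ) ^ 2) ^ (1 / 2 : ℝ) := by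
  simp only [fockNorm, tensorNormSq, ← ENNReal.tsum_mul_left, mul_pow,
    ofReal_weight_tupleMultiset_sq, mul_assoc]

theorem testNorm_mono {p q : ℝ} (h : p ≤ q) : testNorm A β p ≤ testNorm A β q := by
  intro f
  refine ENNReal.toReal_mono (f.2.2 q).ne ?_
  rw [fockNorm_eq, fockNorm_eq]
  gcongr with n J
  exact weight_mono h _

theorem weight_mul_norm_coord_le (p : ℝ) (f : TestSpace A β) (α : Multiset A.Idx) :
    weight A β p α * ‖coord α f‖ ≤ testNorm A β p f := by
  refine (ENNReal.ofReal_le_iff_le_toReal (f.2.2 p).ne).1 ?_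
  rw [ENNReal.ofReal_mul (weight_pos p α).le, ofReal_norm, fockNorm_eq, one_div,
    ENNReal.le_rpow_inv_iff two_pos, ENNReal.rpow_two]
  calc (ENNReal.ofReal (weight A β p α) * ‖coord α f‖ₑ) ^ 2
      = (ENNReal.ofReal (weight A β p (tupleMultiset α.toList.get)) *
          ‖f.1 _ fun i => A.eigenvec (α.toList.get i)‖ₑ) ^ 2 := by
        rw [apply_eigenvec, tupleMultiset_toList_get]
    _ ≤ ∑' J : Fin α.toList.length → A.Idx, (ENNReal.ofReal (weight A β p (tupleMultiset J)) *
          ‖f.1 _ fun i => A.eigenvec (J i)‖ₑ) ^ 2 := ENNReal.le_tsum _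
    _ ≤ _ := ENNReal.le_tsum (f := fun n => ∑' J : Fin n → A.Idx,
          (ENNReal.ofReal (weight A β p (tupleMultiset J)) *
            ‖f.1 n fun i => A.eigenvec (J i)‖ₑ) ^ 2) _

theorem fockNorm_le_of_weight_le {p : ℝ} {M : ℝ≥0∞} {f : ∀ n, Tensor n}
    (h : ∀ n (J : Fin n → A.Idx), ENNReal.ofReal (weight A β (p + A.gap) (tupleMultiset J)) *
      ‖f n fun i => A.eigenvec (J i)‖ₑ ≤ M) :
    fockNorm A β p f ≤ 2 * M := by
  have hterm : ∀ n (J : Fin n → A.Idx), (ENNReal.ofReal (weight A β p (tupleMultiset J)) *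
      ‖f n fun i => A.eigenvec (J i)‖ₑ) ^ 2 ≤
        M ^ 2 * ENNReal.ofReal (eigenvalueProd A (-(2 * A.gap)) (tupleMultiset J)) :=
    fun n J => by
      rw [mul_pow, ← ofReal_weight_add_gap_sq_mul, mul_right_comm, ← mul_pow]
      gcongr
      exact h n J
  rw [fockNorm_eq, one_div, ENNReal.rpow_inv_le_iff two_pos, ENNReal.rpow_two]
  calc _ ≤ ∑' n, ∑' J : Fin n → A.Idx,
        M ^ 2 * ENNReal.ofReal (eigenvalueProd A (-(2 * A.gap)) (tupleMultiset J)) :=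
        ENNReal.tsum_le_tsum fun n => ENNReal.tsum_le_tsum (hterm n)
    _ ≤ M ^ 2 * 2 := by
        simp only [ENNReal.tsum_mul_left]
        gcongr
        exact tsum_tsum_eigenvalueProd_tupleMultiset_le
    _ ≤ (2 * M) ^ 2 := by
        rw [mul_pow, mul_comm, sq 2]
        gcongr
        exact le_mul_of_one_le_left' one_le_two

theorem testNorm_le_of_weight_le {p M : ℝ} {f : TestSpace A β}
    (h : ∀ α, weight A β (p + A.gap) α * ‖coord α f‖ ≤ M) : testNorm A β p f ≤ 2 * M := by
  have hM : 0 ≤ M := (mul_nonneg (weight_pos _ 0).le (norm_nonneg _)).trans (h 0)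
  refine ENNReal.toReal_le_of_le_ofReal (by positivity) ?_
  rw [ENNReal.ofReal_mul zero_le_two, ENNReal.ofReal_ofNat]
  refine fockNorm_le_of_weight_le fun n J => ?_
  rw [apply_eigenvec, ← ofReal_norm, ← ENNReal.ofReal_mul (weight_pos _ _).le]
  exact ENNReal.ofReal_le_ofReal (h _)

variable (A β) in
/-- Families of scalars that are bounded against every weight; these are exactly the families of
coordinates of test functions. -/
def IsRapidlyDecreasing (a : Multiset A.Idx → ℂ) : Prop :=
  ∀ p, ∃ M, ∀ α, weight A β p α * ‖a α‖ ≤ M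

theorem IsRapidlyDecreasing.summable_norm_tupleMultiset {a : Multiset A.Idx → ℂ}
    (ha : IsRapidlyDecreasing A β a) (n : ℕ) :
    Summable fun J : Fin n → A.Idx => ‖a (tupleMultiset J)‖ := by
  obtain ⟨M, hM⟩ := ha (2 * A.gap)
  have hweight : Summable fun J : Fin n → A.Idx =>
      (weight A β (2 * A.gap) (tupleMultiset J))⁻¹ :=
    ((summable_eigenvalueProd_tupleMultiset.sigma_factor n).mul_left
      ((n.factorial : ℝ) ^ ((1 + β) / 2))⁻¹).congr fun J => by
        rw [weight, card_tupleMultiset, eigenvalueProd_neg, mul_inv]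
  refine .of_nonneg_of_le (fun _ => norm_nonneg _) (fun J => ?_) (hweight.mul_right M)
  exact (le_inv_mul_iff₀ (weight_pos _ _)).2 (hM _)

/-- The tensor `∑_J a_J e_{J₁} ⊗ ⋯ ⊗ e_{Jₙ}`. -/
def coeffTensor (a : Multiset A.Idx → ℂ) (n : ℕ) : Tensor n :=
  ∑' J : Fin n → A.Idx, a (tupleMultiset J) •
    (ContinuousMultilinearMap.mkPiAlgebra ℂ (Fin n) ℂ).compContinuousLinearMap
      fun i => bilin (A.eigenvec (J i))

theorem coeffTensor_apply {a : Multiset A.Idx → ℂ} {n : ℕ}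
    (ha : Summable fun J : Fin n → A.Idx => ‖a (tupleMultiset J)‖) (x : Fin n → ComplexL2) :
    coeffTensor a n x =
      ∑' J : Fin n → A.Idx, a (tupleMultiset J) * ∏ i, bilin (A.eigenvec (J i)) (x i) := by
  have hsum : Summable fun J : Fin n → A.Idx => a (tupleMultiset J) •
      (ContinuousMultilinearMap.mkPiAlgebra ℂ (Fin n) ℂ).compContinuousLinearMap
        fun i => bilin (A.eigenvec (J i)) := by
    refine ha.of_norm_bounded fun J => ?_
    rw [norm_smul]
    refine mul_le_of_le_one_right (norm_nonneg _) ?_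
    refine (ContinuousMultilinearMap.norm_compContinuousLinearMap_le _ _).trans ?_
    simp [A.norm_bilin_eigenvec]
  rw [coeffTensor, ContinuousMultilinearMap.tsum_eval hsum]
  simp

theorem coeffTensor_perm {a : Multiset A.Idx → ℂ} {n : ℕ}
    (ha : Summable fun J : Fin n → A.Idx => ‖a (tupleMultiset J)‖) (σ : Equiv.Perm (Fin n))
    (x : Fin n → ComplexL2) : coeffTensor a n (x ∘ σ) = coeffTensor a n x := by
  rw [coeffTensor_apply ha, coeffTensor_apply ha,
    ← (Equiv.arrowCongr σ.symm (Equiv.refl A.Idx)).tsum_eq]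
  refine tsum_congr fun J => ?_
  change a (tupleMultiset (J ∘ σ)) * ∏ i, bilin (A.eigenvec (J (σ i))) (x (σ i)) = _
  rw [tupleMultiset_comp_perm, Equiv.prod_comp σ fun i => bilin (A.eigenvec (J i)) (x i)]

theorem coeffTensor_eigenvec {a : Multiset A.Idx → ℂ} {n : ℕ}
    (ha : Summable fun J : Fin n → A.Idx => ‖a (tupleMultiset J)‖) (K : Fin n → A.Idx) :
    (coeffTensor a n fun i => A.eigenvec (K i)) = a (tupleMultiset K) := by
  classical
  rw [coeffTensor_apply ha, tsum_eq_single K]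
  · simp [A.bilin_eigenvec]
  · intro J hJ
    obtain ⟨i, hi⟩ := Function.ne_iff.1 hJ
    rw [Finset.prod_eq_zero (Finset.mem_univ i), mul_zero]
    simp [A.bilin_eigenvec, hi]

/-- The test function with coordinates `a`. -/
def ofCoord (a : Multiset A.Idx → ℂ) (ha : IsRapidlyDecreasing A β a) : TestSpace A β :=
  ⟨coeffTensor a, fun n => coeffTensor_perm (ha.summable_norm_tupleMultiset n), fun p => by
    obtain ⟨M, hM⟩ := ha (p + A.gap)
    refine (fockNorm_le_of_weight_le (M := ENNReal.ofReal M) fun n J => ?_).trans_lt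
      (ENNReal.mul_lt_top ENNReal.ofNat_lt_top ENNReal.ofReal_lt_top)
    rw [coeffTensor_eigenvec (ha.summable_norm_tupleMultiset n), ← ofReal_norm,
      ← ENNReal.ofReal_mul (weight_pos _ _).le]
    exact ENNReal.ofReal_le_ofReal (hM _)⟩

theorem coord_ofCoord (a : Multiset A.Idx → ℂ) (ha : IsRapidlyDecreasing A β a)
    (α : Multiset A.Idx) : coord α (ofCoord a ha) = a α := by
  refine (coeffTensor_eigenvec (ha.summable_norm_tupleMultiset _) _).trans ?_
  rw [tupleMultiset_toList_get]

/-- The linear map into the test functions with given coordinate functionals. -/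
def linearOfCoord {V : Type*} [AddCommGroup V] [Module ℂ V] (a : Multiset A.Idx → V →ₗ[ℂ] ℂ)
    (ha : ∀ v, IsRapidlyDecreasing A β fun α => a α v) : V →ₗ[ℂ] TestSpace A β where
  toFun v := ofCoord (fun α => a α v) (ha v)
  map_add' v w := ext_coord fun α => by simp only [map_add, coord_ofCoord]
  map_smul' c v := ext_coord fun α => by simp only [map_smul, coord_ofCoord, RingHom.id_apply]

theorem coord_linearOfCoord {V : Type*} [AddCommGroup V] [Module ℂ V]
    (a : Multiset A.Idx → V →ₗ[ℂ] ℂ) (ha : ∀ v, IsRapidlyDecreasing A β fun α => a α v)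
    (α : Multiset A.Idx) (v : V) : coord α (linearOfCoord a ha v) = a α v :=
  coord_ofCoord _ (ha v) α

theorem exists_sup_testNorms_le (s : Finset ℝ) :
    ∃ p, s.sup (testNorms A β) ≤ testNorm A β p :=
  s.exists_le.imp fun _ hp => Finset.sup_le fun q hq => testNorm_mono (hp q hq)

theorem exists_norm_le_mul_testNorm (φ : Distributions A β) :
    ∃ q C : ℝ, 0 ≤ C ∧ ∀ f, ‖φ f‖ ≤ C * testNorm A β q f := by
  obtain ⟨s, C, -, hC⟩ := Seminorm.bound_of_continuous (testSpace_withSeminorms A β)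
    ((normSeminorm ℂ ℂ).comp φ.toLinearMap) (continuous_norm.comp φ.continuous)
  obtain ⟨q, hq⟩ := exists_sup_testNorms_le (A := A) (β := β) s
  exact ⟨q, C, C.2, fun f => (hC f).trans (mul_le_mul_of_nonneg_left (hq f) C.2)⟩

theorem continuous_of_weight_mul_norm_coord_le {β' : ℝ}
    (T : TestSpace A β →ₗ[ℂ] TestSpace A β')
    (hT : ∀ p, ∃ r C : ℝ, 0 ≤ C ∧
      ∀ f α, weight A β' p α * ‖coord α (T f)‖ ≤ C * testNorm A β r f) :
    Continuous T := by
  refine (testSpace_withSeminorms A β).continuous_of_isBounded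
    (testSpace_withSeminorms A β') _ fun p => ?_
  obtain ⟨r, C, hC, h⟩ := hT (p + A.gap)
  refine ⟨{r}, ⟨2 * C, by positivity⟩, fun f => ?_⟩
  rw [Finset.sup_singleton]
  change testNorm A β' p (T f) ≤ 2 * C * testNorm A β r f
  rw [mul_assoc]
  exact testNorm_le_of_weight_le (h f)

/-- The coordinate at `α` as a generalized function. -/
def coordCLM (α : Multiset A.Idx) : Distributions A β :=
  ⟨coord α, by
    refine (testSpace_withSeminorms A β).continuous_normedSpace_rng ℂ _
      ⟨{0}, ⟨(weight A β 0 α)⁻¹, (inv_pos.2 (weight_pos 0 α)).le⟩, fun f => ?_⟩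
    rw [Finset.sup_singleton]
    exact (le_inv_mul_iff₀ (weight_pos 0 α)).2 (weight_mul_norm_coord_le 0 f α)⟩

/-! ### Convolution operators -/

theorem weight_mul_choose_mul_norm_coord_le (p q : ℝ) (f : TestSpace A β)
    (γ α : Multiset A.Idx) :
    weight A β p γ * (weight A β q α *
      ‖((Multiset.card (α + γ)).choose (Multiset.card γ) : ℂ) * coord (α + γ) f‖) ≤
      testNorm A β (max p q + A.gap * |1 - β|) f := by
  refine le_trans ?_ (weight_mul_norm_coord_le _ f (α + γ))
  have hpγ : weight A β p γ ≤ weight A β (max p q) γ := weight_mono (le_max_left p q) γ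
  have hqα : weight A β q α ≤ weight A β (max p q) α := weight_mono (le_max_right p q) α
  have hp : 0 ≤ weight A β (max p q) γ := (weight_pos _ γ).le
  have hq : 0 ≤ weight A β q α := (weight_pos q α).le
  rw [norm_mul, Complex.norm_natCast, ← mul_assoc, ← mul_assoc]
  refine mul_le_mul_of_nonneg_right ?_ (norm_nonneg _)
  refine le_trans ?_ (weight_mul_weight_mul_choose_le (max p q) γ α)
  gcongr

/-- The operator multiplying the coordinate at `α + γ` by `|α + γ| choose |γ|` and moving it to
`α`; up to a factor, the derivative of order `γ`. -/
def shift (γ : Multiset A.Idx) : TestSpace A β →ₗ[ℂ] TestSpace A β :=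
  linearOfCoord
    (fun α => ((Multiset.card (α + γ)).choose (Multiset.card γ) : ℂ) • coord (α + γ))
    fun f p => ⟨_, fun α =>
      (le_inv_mul_iff₀ (weight_pos p γ)).2 (weight_mul_choose_mul_norm_coord_le p p f γ α)⟩

theorem coord_shift (γ α : Multiset A.Idx) (f : TestSpace A β) :
    coord α (shift γ f) =
      ((Multiset.card (α + γ)).choose (Multiset.card γ) : ℂ) * coord (α + γ) f :=
  coord_linearOfCoord _ _ α f

theorem weight_mul_testNorm_shift_le (p q : ℝ) (f : TestSpace A β) (γ : Multiset A.Idx) :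
    weight A β p γ * testNorm A β q (shift γ f) ≤
      2 * testNorm A β (max p (q + A.gap) + A.gap * |1 - β|) f := by
  have hγ := weight_pos (β := β) p γ
  rw [← le_div_iff₀' hγ, mul_div_assoc]
  refine testNorm_le_of_weight_le fun α => ?_
  rw [le_div_iff₀' hγ, coord_shift]
  exact weight_mul_choose_mul_norm_coord_le _ _ f γ α

theorem exists_weight_mul_norm_apply_shift_le (φ : Distributions A β) (p : ℝ) :
    ∃ r C : ℝ, 0 ≤ C ∧ ∀ (f : TestSpace A β) γ,
      weight A β p γ * ‖φ (shift γ f)‖ ≤ C * testNorm A β r f := by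
  obtain ⟨q, C, hC, hφ⟩ := exists_norm_le_mul_testNorm φ
  refine ⟨max p (q + A.gap) + A.gap * |1 - β|, C * 2, by positivity, fun f γ => ?_⟩
  calc weight A β p γ * ‖φ (shift γ f)‖
      ≤ weight A β p γ * (C * testNorm A β q (shift γ f)) :=
        mul_le_mul_of_nonneg_left (hφ _) (weight_pos p γ).le
    _ = C * (weight A β p γ * testNorm A β q (shift γ f)) := mul_left_comm _ _ _
    _ ≤ C * (2 * testNorm A β (max p (q + A.gap) + A.gap * |1 - β|) f) :=
        mul_le_mul_of_nonneg_left (weight_mul_testNorm_shift_le p q f γ) hC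
    _ = C * 2 * testNorm A β (max p (q + A.gap) + A.gap * |1 - β|) f := (mul_assoc _ _ _).symm

theorem isRapidlyDecreasing_apply_shift (φ : Distributions A β) (f : TestSpace A β) :
    IsRapidlyDecreasing A β fun γ => (φ.toLinearMap ∘ₗ shift γ) f := fun p =>
  let ⟨_, _, _, h⟩ := exists_weight_mul_norm_apply_shift_le φ p
  ⟨_, h f⟩

/-- The convolution operator `C_φ`, given by `(C_φ f)_γ = φ (shift γ f)`. -/
def conv (φ : Distributions A β) : TestSpace A β →L[ℂ] TestSpace A β where
  toLinearMap := linearOfCoord _ (isRapidlyDecreasing_apply_shift φ)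
  cont := continuous_of_weight_mul_norm_coord_le _ fun p => by
    simp only [coord_linearOfCoord]
    exact exists_weight_mul_norm_apply_shift_le φ p

theorem coord_conv (φ : Distributions A β) (f : TestSpace A β) (γ : Multiset A.Idx) :
    coord γ (conv φ f) = φ (shift γ f) :=
  coord_linearOfCoord _ _ γ f

theorem isVonNBounded_weight_smul_shift (p : ℝ) {S : Set (TestSpace A β)}
    (hS : Bornology.IsVonNBounded ℂ S) : Bornology.IsVonNBounded ℂ
      (Set.image2 (fun γ f => (weight A β p γ : ℂ) • shift γ f) Set.univ S) := by
  rw [(testSpace_withSeminorms A β).isVonNBounded_iff_seminorm_bounded] at hS ⊢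
  intro q
  obtain ⟨r, hr, hSr⟩ := hS (max p (q + A.gap) + A.gap * |1 - β|)
  refine ⟨2 * r, by positivity, ?_⟩
  rintro _ ⟨γ, -, f, hf, rfl⟩
  calc testNorm A β q ((weight A β p γ : ℂ) • shift γ f)
      = weight A β p γ * testNorm A β q (shift γ f) := by
        rw [map_smul_eq_mul, Complex.norm_real, Real.norm_of_nonneg (weight_pos _ _).le]
    _ ≤ 2 * testNorm A β (max p (q + A.gap) + A.gap * |1 - β|) f :=
        weight_mul_testNorm_shift_le p q f γ
    _ < 2 * r := mul_lt_mul_of_pos_left (hSr f hf) two_pos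

/-- The map `φ ↦ C_φ`, as a linear map. -/
def convLinear : Distributions A β →ₗ[ℂ] (TestSpace A β →L[ℂ] TestSpace A β) where
  toFun := conv
  map_add' φ ψ := ContinuousLinearMap.ext fun f => ext_coord fun α => by
    simp only [add_apply, map_add, coord_conv]
  map_smul' c φ := ContinuousLinearMap.ext fun f => ext_coord fun α => by
    simp only [smul_apply, map_smul, coord_conv, RingHom.id_apply]

theorem testNorm_conv_le {φ : Distributions A β} {f : TestSpace A β} {p r : ℝ}
    (h : ∀ γ, ‖φ ((weight A β (p + A.gap) γ : ℂ) • shift γ f)‖ ≤ r) :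
    testNorm A β p (conv φ f) ≤ 2 * r := by
  refine testNorm_le_of_weight_le fun γ => ?_
  convert h γ using 1
  rw [coord_conv, map_smul, norm_smul, Complex.norm_real,
    Real.norm_of_nonneg (weight_pos _ _).le]

theorem continuous_convLinear : Continuous (convLinear (A := A) (β := β)) := by
  refine continuous_of_continuousAt_zero _ ?_
  rw [ContinuousAt, map_zero]
  have hbasis := ContinuousLinearMap.hasBasis_nhds_zero_of_basis (σ := RingHom.id ℂ)
    (E := TestSpace A β) (testSpace_withSeminorms A β).hasBasis_zero_ball
  have hbasis_dual := ContinuousLinearMap.hasBasis_nhds_zero_of_basis (σ := RingHom.id ℂ)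
    (E := TestSpace A β) (F := ℂ) Metric.nhds_basis_ball
  refine (hbasis_dual.tendsto_iff hbasis).2 ?_
  rintro ⟨S, s, r⟩ ⟨hS, hr : 0 < r⟩
  obtain ⟨p, hp⟩ := exists_sup_testNorms_le (A := A) (β := β) s
  refine ⟨(_, r / 4), ⟨isVonNBounded_weight_smul_shift (p + A.gap) hS,
    div_pos hr four_pos⟩, fun φ hφ f hf => (Seminorm.mem_ball_zero _).2 ?_⟩
  calc s.sup (testNorms A β) (conv φ f) ≤ testNorm A β p (conv φ f) := hp _
    _ ≤ 2 * (r / 4) := testNorm_conv_le fun γ =>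
        (mem_ball_zero_iff.1 (hφ _ ⟨γ, trivial, f, hf, rfl⟩)).le
    _ < r := by linarith

/-- The map `φ ↦ C_φ`. -/
def convHom : Distributions A β →L[ℂ] (TestSpace A β →L[ℂ] TestSpace A β) :=
  ⟨convLinear, continuous_convLinear⟩

/-- The vacuum expectation `f ↦ f₀`, which is the unit of the Wick product. -/
def vacuum : Distributions A β := coordCLM 0

theorem vacuum_apply (f : TestSpace A β) : vacuum f = coord 0 f := rfl

theorem shift_zero (f : TestSpace A β) : shift 0 f = f :=
  ext_coord fun α => by simp [coord_shift]

theorem vacuum_conv (φ : Distributions A β) (f : TestSpace A β) : vacuum (conv φ f) = φ f := by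
  rw [vacuum_apply, coord_conv, shift_zero]

theorem conv_vacuum : conv vacuum = ContinuousLinearMap.id ℂ (TestSpace A β) :=
  ContinuousLinearMap.ext fun f => ext_coord fun α => by
    rw [coord_conv, vacuum_apply, coord_shift]
    simp

/-- The map `T ↦ (f ↦ (T f)₀)`, which recovers `φ` from `C_φ`. -/
def vacuumComp : (TestSpace A β →L[ℂ] TestSpace A β) →L[ℂ] Distributions A β :=
  ContinuousLinearMap.postcomp (TestSpace A β) vacuum

theorem vacuumComp_convHom (φ : Distributions A β) : vacuumComp (convHom φ) = φ :=
  ContinuousLinearMap.ext fun f => vacuum_conv φ f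

theorem convHom_injective : Function.Injective (convHom (A := A) (β := β)) :=
  Function.LeftInverse.injective (g := vacuumComp) vacuumComp_convHom

/-- `φ ↦ C_φ`, as a topological isomorphism onto its image. -/
def convEquiv :
    Distributions A β ≃L[ℂ] LinearMap.range (convHom (A := A) (β := β)).toLinearMap :=
  ContinuousLinearEquiv.equivOfInverse
    (convHom.codRestrict _ fun φ => LinearMap.mem_range_self _ φ)
    (vacuumComp.comp (Submodule.subtypeL _))
    (fun φ => vacuumComp_convHom φ)
    (by
      rintro ⟨_, φ, rfl⟩
      exact Subtype.ext (congrArg convHom (vacuumComp_convHom φ)))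

/-! ### The `S`-transform and the Wick product -/

variable (A β) in
open Classical in
/-- The test function with a single nonzero coordinate, `1` at `α`. -/
def unitVec (α : Multiset A.Idx) : TestSpace A β :=
  ofCoord (Pi.single α 1) fun p => ⟨weight A β p α, fun γ => by
    rcases eq_or_ne γ α with rfl | h
    · simp
    · simp [h, (weight_pos p α).le]⟩

open Classical in
theorem coord_unitVec (α γ : Multiset A.Idx) :
    coord γ (unitVec A β α) = if γ = α then 1 else 0 :=
  (coord_ofCoord _ _ γ).trans (Pi.single_apply α 1 γ)

theorem weight_mul_norm_coord_le_mul_eigenvalueProd (p : ℝ) (f : TestSpace A β)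
    (α : Multiset A.Idx) : weight A β p α * ‖coord α f‖ ≤
      testNorm A β (p + 2 * A.gap) f * eigenvalueProd A (-(2 * A.gap)) α := by
  rw [eigenvalueProd_neg, le_mul_inv_iff₀ (eigenvalueProd_pos _ _), mul_right_comm, ← weight_add]
  exact weight_mul_norm_coord_le _ f α

open Classical in
theorem coord_sum_coord_smul_unitVec (s : Finset (Multiset A.Idx)) (f : TestSpace A β)
    (γ : Multiset A.Idx) :
    coord γ (∑ α ∈ s, coord α f • unitVec A β α) = if γ ∈ s then coord γ f else 0 := by
  simp [coord_unitVec]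

theorem hasSum_coord_smul_unitVec (f : TestSpace A β) :
    HasSum (fun α => coord α f • unitVec A β α) f := by
  classical
  refine ((testSpace_withSeminorms A β).tendsto_nhds _ f).2 fun p ε hε => ?_
  have hdecay := (summable_eigenvalueProd (A := A)).tendsto_cofinite_zero.const_mul
    (testNorm A β (p + A.gap + 2 * A.gap) f)
  rw [mul_zero] at hdecay
  have hlarge := Filter.eventually_cofinite.1
    (hdecay.eventually_lt_const (show 0 < ε / 4 by positivity))
  filter_upwards [Filter.eventually_ge_atTop hlarge.toFinset] with s hs
  suffices hcoord : ∀ γ, weight A β (p + A.gap) γ *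
      ‖coord γ (∑ α ∈ s, coord α f • unitVec A β α - f)‖ ≤ ε / 4 from
    (testNorm_le_of_weight_le hcoord).trans_lt (by linarith)
  intro γ
  rw [map_sub, coord_sum_coord_smul_unitVec]
  split_ifs with hγ
  · rw [sub_self, norm_zero, mul_zero]
    positivity
  · rw [zero_sub, norm_neg]
    refine (weight_mul_norm_coord_le_mul_eigenvalueProd _ f γ).trans (le_of_not_gt fun hlt => hγ ?_)
    exact hs (hlarge.mem_toFinset.2 hlt.not_gt)

theorem bilin_comm (ξ η : ComplexL2) : bilin ξ η = bilin η ξ := by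
  simp only [bilin_apply, mul_comm]

theorem bilin_sum_smul_eigenvec (T : Finset A.Idx) (z : A.Idx → ℂ) (hz : ∀ j ∉ T, z j = 0)
    (j : A.Idx) : bilin (∑ i ∈ T, z i • A.eigenvec i) (A.eigenvec j) = z j := by
  classical
  rw [bilin_comm]
  simp only [map_sum, map_smul, A.bilin_eigenvec, smul_eq_mul, mul_ite, mul_one, mul_zero,
    Finset.sum_ite_eq]
  split_ifs with hj
  · rfl
  · exact (hz j hj).symm

theorem exists_mem_EC (T : Finset A.Idx) (z : A.Idx → ℂ) (hz : ∀ j ∉ T, z j = 0) :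
    ∃ ξ : EC A, ∀ j, bilin ξ (A.eigenvec j) = z j := by
  refine ⟨⟨∑ i ∈ T, z i • A.eigenvec i, fun p => ?_⟩, bilin_sum_smul_eigenvec T z hz⟩
  rw [vecNormSq, tsum_eq_sum (s := T)]
  · exact ENNReal.sum_lt_top.2 fun j _ =>
      ENNReal.mul_lt_top ENNReal.ofReal_lt_top (ENNReal.pow_lt_top enorm_lt_top)
  · intro j hj
    simp [bilin_sum_smul_eigenvec T z hz, hz j hj]

theorem coord_expVector (hβ : β < 1) (ξ : EC A) (α : Multiset A.Idx) :
    coord α (expVector A hβ ξ) = ((Multiset.card α).factorial : ℂ)⁻¹ *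
      (α.map fun j => bilin ξ (A.eigenvec j)).prod := by
  refine (expCoeff_apply _ _ _).trans ?_
  rw [← prod_map_tupleMultiset α.toList.get fun j => bilin ξ (A.eigenvec j),
    tupleMultiset_toList_get, Multiset.length_toList]

theorem eq_zero_of_sTransform_eq_zero (hβ : β < 1) {φ : Distributions A β}
    (hφ : ∀ ξ, sTransform A hβ φ ξ = 0) : φ = 0 := by
  have hsum : ∀ f, HasSum (fun α => coord α f * φ (unitVec A β α)) (φ f) := fun f => by
    simpa only [map_smul, smul_eq_mul] using (hasSum_coord_smul_unitVec f).mapL φ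
  have hcoeff : ∀ α : Multiset A.Idx,
      ((Multiset.card α).factorial : ℂ)⁻¹ * φ (unitVec A β α) = 0 := by
    refine eq_zero_of_hasSum_mul_prod fun T z hz => ?_
    obtain ⟨ξ, hξ⟩ := exists_mem_EC T z hz
    refine hφ ξ ▸ (hsum (expVector A hβ ξ)).congr_fun fun α => ?_
    rw [coord_expVector, mul_right_comm]
    simp only [hξ]
  have hunit : ∀ α, φ (unitVec A β α) = 0 := fun α =>
    (mul_eq_zero.1 (hcoeff α)).resolve_left
      (inv_ne_zero (Nat.cast_ne_zero.2 (Nat.factorial_ne_zero _)))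
  refine ContinuousLinearMap.ext fun f => (hsum f).unique ?_
  simp only [hunit, mul_zero]
  exact hasSum_zero

theorem sTransform_injective (hβ : β < 1) : Function.Injective (sTransform A hβ) :=
  fun _ _ h => sub_eq_zero.1 <| eq_zero_of_sTransform_eq_zero hβ fun ξ =>
    sub_eq_zero.2 (congrFun h ξ)

theorem shift_expVector (hβ : β < 1) (ξ : EC A) (γ : Multiset A.Idx) :
    shift γ (expVector A hβ ξ) = coord γ (expVector A hβ ξ) • expVector A hβ ξ := by
  refine ext_coord fun α => ?_
  simp only [coord_shift, map_smul, smul_eq_mul, coord_expVector, Multiset.map_add,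
    Multiset.prod_add, Multiset.card_add]
  rw [add_comm (Multiset.card α), Nat.cast_add_choose]
  have hfact : ((Multiset.card γ + Multiset.card α).factorial : ℂ) ≠ 0 :=
    Nat.cast_ne_zero.2 (Nat.factorial_ne_zero _)
  field_simp

theorem conv_expVector (hβ : β < 1) (φ : Distributions A β) (ξ : EC A) :
    conv φ (expVector A hβ ξ) = sTransform A hβ φ ξ • expVector A hβ ξ :=
  ext_coord fun α => by
    rw [coord_conv, shift_expVector, map_smul, map_smul, sTransform, smul_eq_mul, smul_eq_mul,
      mul_comm]

theorem sTransform_comp_conv (hβ : β < 1) (φ ψ : Distributions A β) :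
    sTransform A hβ (ψ.comp (conv φ)) = sTransform A hβ φ * sTransform A hβ ψ :=
  funext fun ξ => (congrArg ψ (conv_expVector hβ φ ξ)).trans (map_smul ψ _ _)

theorem wick_eq_comp_conv (hβ : β < 1) (φ ψ : Distributions A β) :
    wick A hβ φ ψ = ψ.comp (conv φ) :=
  (congrArg (Function.invFun (sTransform A hβ)) (sTransform_comp_conv hβ φ ψ).symm).trans
    (Function.leftInverse_invFun (sTransform_injective hβ) _)

theorem sTransform_wick (hβ : β < 1) (φ ψ : Distributions A β) :
    sTransform A hβ (wick A hβ φ ψ) = sTransform A hβ φ * sTransform A hβ ψ := by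
  rw [wick_eq_comp_conv, sTransform_comp_conv]

theorem conv_wick (hβ : β < 1) (φ ψ : Distributions A β) :
    conv (wick A hβ φ ψ) = (conv φ).comp (conv ψ) := by
  have hdual : ∀ θ : Distributions A β,
      θ.comp (conv (wick A hβ φ ψ)) = (θ.comp (conv φ)).comp (conv ψ) := fun θ => by
    apply sTransform_injective hβ
    simp only [sTransform_comp_conv, sTransform_wick]
    ring
  exact ContinuousLinearMap.ext fun f => ext_coord fun γ =>
    DFunLike.congr_fun (hdual (coordCLM γ)) f

theorem vacuum_wick (hβ : β < 1) (φ : Distributions A β) : wick A hβ vacuum φ = φ := by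
  rw [wick_eq_comp_conv, conv_vacuum, ContinuousLinearMap.comp_id]

end WhiteNoise

end

open WhiteNoise in
theorem mainTheorem3_general (A : TripleOperator) (β : ℝ) (hβ : β < 1) :
    Function.Injective (sTransform A hβ) ∧
    (∀ φ ψ, sTransform A hβ (wick A hβ φ ψ) = sTransform A hβ φ * sTransform A hβ ψ) ∧
    ∃ (M : Distributions A β → Distributions A β →L[ℂ] Distributions A β)
      (C : Distributions A β →L[ℂ] (TestSpace A β →L[ℂ] TestSpace A β)),
      (∀ φ ψ, M φ ψ = wick A hβ φ ψ) ∧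
      (∀ φ ψ (f : TestSpace A β), ψ (C φ f) = M φ ψ f) ∧
      (∀ φ ψ, C (wick A hβ φ ψ) = (C φ).comp (C ψ)) ∧
      (∃ ε, (∀ φ, wick A hβ ε φ = φ) ∧ C ε = ContinuousLinearMap.id ℂ (TestSpace A β)) ∧
      Function.Injective C ∧
      ∃ e : Distributions A β ≃L[ℂ] LinearMap.range C.toLinearMap, ∀ φ,
        (e φ : TestSpace A β →L[ℂ] TestSpace A β) = C φ := by
  exact ⟨sTransform_injective hβ, sTransform_wick hβ,
    fun φ => ContinuousLinearMap.precomp ℂ (conv φ), convHom,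
    fun φ ψ => (wick_eq_comp_conv hβ φ ψ).symm, fun _ _ _ => rfl, conv_wick hβ,
    ⟨vacuum, vacuum_wick hβ, conv_vacuum⟩, convHom_injective, convEquiv, fun _ => rfl⟩

open WhiteNoise in
theorem mainTheorem3 (A : TripleOperator) (β : ℝ) (hβ₀ : 0 ≤ β) (hβ : β < 1) :
    -- the Wick product is well defined
    Function.Injective (sTransform A hβ) ∧
    (∀ φ ψ, sTransform A hβ (wick A hβ φ ψ) = sTransform A hβ φ * sTransform A hβ ψ) ∧
    ∃ (M : Distributions A β → Distributions A β →L[ℂ] Distributions A β)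
      (C : Distributions A β →L[ℂ] (TestSpace A β →L[ℂ] TestSpace A β)),
      -- `M φ` is Wick multiplication by `φ`, and `C φ` is the operator whose dual is `M φ`
      (∀ φ ψ, M φ ψ = wick A hβ φ ψ) ∧
      (∀ φ ψ (f : TestSpace A β), ψ (C φ f) = M φ ψ f) ∧
      -- `C` is an injective homomorphism of (unital) algebras
      (∀ φ ψ, C (wick A hβ φ ψ) = (C φ).comp (C ψ)) ∧
      (∃ ε, (∀ φ, wick A hβ ε φ = φ) ∧ C ε = ContinuousLinearMap.id ℂ (TestSpace A β)) ∧
      Function.Injective C ∧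
      -- `C` is a topological isomorphism onto its image
      ∃ e : Distributions A β ≃L[ℂ] LinearMap.range C.toLinearMap, ∀ φ,
        (e φ : TestSpace A β →L[ℂ] TestSpace A β) = C φ :=
  mainTheorem3_general A β hβ
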